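/- Let $D\subset\mathbb R^3$ be a bounded open set with Lipschitz boundary (locally, after a rigid motion, $D$ is the set of points above the graph of a Lipschitz function), with surface measure $\sigma$ on $\partial D$ and outward unit normal $\nu$ (defined $\sigma$-a.e.). Let $H^{1/2}(\partial D)$ be the space of complex $f\in L^2(\partial D)$ with $$\|f\|_{H^{1/2}}^2=\int_{\partial D}|f|^2\,d\sigma+\int_{\partial D}\int_{\partial D}\frac{|f(x)-f(y)|^2}{|x-y|^3}\,d\sigma(x)\,d\sigma(y)<\infty,$$ and let $H^{-1/2}(\partial D)$ be its dual, with the operator norm and the bilinear pairing $\langle\psi,f\rangle$ that extends $\int_{\partial D}\psi f\,d\sigma$; thus $L^2(\partial D)\subset H^{-1/2}(\partial D)$. For $k\in\mathbb C$ and $x\neq0$ let $\Gamma^k(x)=-\frac{1}{4\pi|x|}e^{ik|x|}$ and define $\Gamma_1^k$ by $$\Gamma^k(x)=\Gamma^0(x)-\frac{ik}{4\pi}+k^2\,\Gamma_1^k(x),$$ where for $k=0$ the removable singularity is filled in: $\Gamma_1^0(x)=\lim_{k\to0}\Gamma_1^k(x)=\frac{|x|}{8\pi}$; also $\Gamma_1^k(0)=0$.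 Then, for every $k\in\mathbb C$ and $x\in\partial D$, the function $y\mapsto\Gamma_1^k(x-y)$ belongs to $H^{1/2}(\partial D)$, and so does $y\mapsto\frac{\partial\Gamma_1^k(x-y)}{\partial\nu(x)}=\nu(x)\cdot\nabla\Gamma_1^k(x-y)$ whenever $\nu(x)$ exists. The formulas $$S_1^k[\psi](x)=\int_{\partial D}\Gamma_1^k(x-y)\,\psi(y)\,d\sigma(y),\qquad K_1^{*,k}[\psi](x)=\int_{\partial D}\frac{\partial\Gamma_1^k(x-y)}{\partial\nu(x)}\,\psi(y)\,d\sigma(y),$$ in which for $\psi\in H^{-1/2}(\partial D)$ the integrals are the duality pairings of $\psi$ with the kernels as functions of $y$, define, for $\sigma$-a.e. $x\in\partial D$, functions $S_1^k[\psi]\in H^{1/2}(\partial D)$ and $K_1^{*,k}[\psi]\in L^2(\partial D)\subset H^{-1/2}(\partial D)$, and bounded linear operators $$S_1^k:H^{-1/2}(\partial D)\to H^{1/2}(\partial D),\qquad K_1^{*,k}:H^{-1/2}(\partial D)\to H^{-1/2}(\partial D).$$ These operators are compact for every $k\in\mathbb C$, and the operator-valued maps $k\mapsto S_1^k$ and $k\mapsto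 K_1^{*,k}$ are analytic on $\mathbb C$ (with respect to the operator norms). -/

import Mathlib

open MeasureTheory Topology

noncomputable section

/-- Euclidean space `ℝ³`. -/
abbrev E3 : Type := EuclideanSpace ℝ (Fin 3)

/-- `D` is a bounded open set with Lipschitz boundary: near each boundary point, after a linear
isometric change of the coordinates, `D` is the set of points lying strictly on one side of
(above) the graph of a Lipschitz function of the first two coordinates. -/
structure IsBoundedLipschitzDomain (D : Set E3) : Prop where
  isBounded : Bornology.IsBounded D
  isOpen : IsOpen D
  lipschitz_boundary : ∀ x ∈ frontier D, ∃ r : ℝ, 0 < r ∧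
    ∃ (L : E3 ≃ₗᵢ[ℝ] E3) (C : NNReal) (φ : EuclideanSpace ℝ (Fin 2) → ℝ),
      LipschitzWith C φ ∧
        ∀ y ∈ Metric.ball x r, y ∈ D ↔ φ !₂[L y 0, L y 1] < L y 2

/-- Surface measure `σ` on `∂D`: the two-dimensional Hausdorff measure, normalised so that it is
area on planes, restricted to `∂D`. -/
def surfaceMeasure (D : Set E3) : Measure E3 :=
  (μHE[2] : Measure E3).restrict (frontier D)

/-- `n` is an outward unit normal of `D` at `x`: up to an error `o(|y - x|)`, the set `D` agrees
near `x` with the half-space `⟪y - x, n⟫ < 0`. -/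
def IsOutwardUnitNormal (D : Set E3) (x n : E3) : Prop :=
  ‖n‖ = 1 ∧ ∀ ε : ℝ, 0 < ε → ∀ᶠ y in 𝓝 x,
    (inner ℝ (y - x) n < -ε * ‖y - x‖ → y ∈ D) ∧ (ε * ‖y - x‖ < inner ℝ (y - x) n → y ∉ D)

/-- There is at most one outward unit normal at a point. -/
theorem IsOutwardUnitNormal.unique {D : Set E3} {x n m : E3}
    (hn : IsOutwardUnitNormal D x n) (hm : IsOutwardUnitNormal D x m) : n = m := by
  by_contra hne
  have hc : inner ℝ n m < 1 := inner_lt_one_iff_real_of_norm_eq_one hn.1 hm.1 |>.2 hne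
  set v : E3 := m - n with hv
  have h1 : inner ℝ v n = inner ℝ n m - 1 := by
    rw [hv, inner_sub_left, real_inner_self_eq_norm_sq, hn.1, real_inner_comm]; ring
  have h2 : inner ℝ v m = 1 - inner ℝ n m := by
    rw [hv, inner_sub_left, real_inner_self_eq_norm_sq, hm.1]; ring
  have hv0 : 0 < ‖v‖ := norm_pos_iff.2 (sub_ne_zero.2 (Ne.symm hne))
  set ε : ℝ := (1 - inner ℝ n m) / (2 * ‖v‖) with hε
  have hεp : 0 < ε := by have : 0 < 1 - inner ℝ n m := by linarith
                         positivity
  have hεv : ε * ‖v‖ = (1 - inner ℝ n m) / 2 := by rw [hε]; field_simp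
  have ht : Filter.Tendsto (fun t : ℝ => x + t • v) (𝓝[>] 0) (𝓝 x) := by
    have : Continuous (fun t : ℝ => x + t • v) := by fun_prop
    have h := this.tendsto 0
    simp only [zero_smul, add_zero] at h
    exact h.mono_left nhdsWithin_le_nhds
  obtain ⟨t, ⟨ha, hb⟩, htp⟩ := ((ht.eventually ((hn.2 ε hεp).and (hm.2 ε hεp))).and
    self_mem_nhdsWithin).exists
  have htp : 0 < t := htp
  have e : x + t • v - x = t • v := by simp
  rw [e, norm_smul, Real.norm_of_nonneg htp.le, real_inner_smul_left] at ha hb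
  refine hb.2 ?_ (ha.1 ?_)
  · rw [h2, mul_left_comm, hεv]
    nlinarith
  · rw [h1, neg_mul, mul_left_comm, hεv]
    nlinarith

open Classical in
/-- The outward unit normal `ν(x)` (and `0` at the points that have none; on a Lipschitz boundary
these form a null set). -/
def outwardNormal (D : Set E3) (x : E3) : E3 :=
  if h : ∃ n, IsOutwardUnitNormal D x n then h.choose else 0

/-- The measure `|x - y|⁻³ dσ(x) dσ(y)` of the Sobolev–Slobodeckij seminorm of order `1/2` on a
surface. -/
def slobodeckijMeasure (D : Set E3) : Measure (E3 × E3) :=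
  ((surfaceMeasure D).prod (surfaceMeasure D)).withDensity
    fun p => (ENNReal.ofReal (‖p.1 - p.2‖ ^ 3))⁻¹

/-- The complex Sobolev space `H^{1/2}(∂D)`: all `f ∈ L²(∂D, σ)` for which
`f(x) - f(y) ∈ L²(|x - y|⁻³ dσ(x) dσ(y))`. Such an `f` is stored as the pair
`(f, (x, y) ↦ f(x) - f(y))` in the Hilbert sum of the two `L²` spaces, so that the inherited norm
is `‖f‖² = ∫ |f|² dσ + ∫∫ |f(x) - f(y)|² / |x - y|³ dσ(x) dσ(y)`. -/
def HHalfSubmodule (D : Set E3) : Submodule ℂ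
    (WithLp 2 (Lp ℂ 2 (surfaceMeasure D) × Lp ℂ 2 (slobodeckijMeasure D))) where
  carrier := {u | ∃ f : E3 → ℂ, u.fst =ᵐ[surfaceMeasure D] f ∧
    u.snd =ᵐ[slobodeckijMeasure D] fun p => f p.1 - f p.2}
  zero_mem' := by
    refine ⟨0, ?_, ?_⟩
    · exact Lp.coeFn_zero _ _ _
    · filter_upwards [Lp.coeFn_zero ℂ 2 (slobodeckijMeasure D)] with p hp
      simpa using hp
  add_mem' := by
    rintro u v ⟨f, hf, hf'⟩ ⟨g, hg, hg'⟩
    refine ⟨f + g, ?_, ?_⟩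
    · filter_upwards [Lp.coeFn_add u.fst v.fst, hf, hg] with x h h1 h2
      rw [WithLp.add_fst, h, Pi.add_apply, h1, h2, Pi.add_apply]
    · filter_upwards [Lp.coeFn_add u.snd v.snd, hf', hg'] with x h h1 h2
      rw [WithLp.add_snd, h, Pi.add_apply, h1, h2, Pi.add_apply, Pi.add_apply]
      ring
  smul_mem' := by
    rintro c u ⟨f, hf, hf'⟩
    refine ⟨c • f, ?_, ?_⟩
    · filter_upwards [Lp.coeFn_smul c u.fst, hf] with x h h1
      rw [WithLp.smul_fst, h, Pi.smul_apply, h1, Pi.smul_apply]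
    · filter_upwards [Lp.coeFn_smul c u.snd, hf'] with x h h1
      rw [WithLp.smul_snd, h, Pi.smul_apply, h1, Pi.smul_apply, Pi.smul_apply, smul_sub]

/-- The normed space `H^{1/2}(∂D)`, with the norm described above. -/
def HHalf (D : Set E3) : Type := HHalfSubmodule D

instance HHalf.instNormedAddCommGroup (D : Set E3) : NormedAddCommGroup (HHalf D) :=
  inferInstanceAs (NormedAddCommGroup (HHalfSubmodule D))

instance HHalf.instInnerProductSpace (D : Set E3) : InnerProductSpace ℂ (HHalf D) :=
  inferInstanceAs (InnerProductSpace ℂ (HHalfSubmodule D))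

/-- The embedding `H^{1/2}(∂D) → L²(∂D)`. -/
def HHalf.toL2 (D : Set E3) : HHalf D →L[ℂ] Lp ℂ 2 (surfaceMeasure D) :=
  show HHalfSubmodule D →L[ℂ] Lp ℂ 2 (surfaceMeasure D) from
  (WithLp.fstL 2 ℂ (Lp ℂ 2 (surfaceMeasure D)) (Lp ℂ 2 (slobodeckijMeasure D))).comp
    (HHalfSubmodule D).subtypeL

/-- `H^{-1/2}(∂D)`, the dual space of `H^{1/2}(∂D)` with the operator norm. The (complex bilinear)
duality pairing `⟨ψ, u⟩` is the application `ψ u`. -/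
abbrev HNegHalf (D : Set E3) : Type := HHalf D →L[ℂ] ℂ

/-- The embedding `L²(∂D) → H^{-1/2}(∂D)`, `⟨g, u⟩ = ∫ g u dσ`. -/
def HNegHalf.ofL2 (D : Set E3) (g : Lp ℂ 2 (surfaceMeasure D)) : HNegHalf D :=
  ((ContinuousLinearMap.mul ℂ ℂ).lpPairing (surfaceMeasure D) 2 2 g).comp (HHalf.toL2 D)

theorem HNegHalf.ofL2_apply (D : Set E3) (g : Lp ℂ 2 (surfaceMeasure D)) (u : HHalf D) :
    HNegHalf.ofL2 D g u = ∫ y, g y * HHalf.toL2 D u y ∂(surfaceMeasure D) := by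
  simp [HNegHalf.ofL2, ContinuousLinearMap.lpPairing_eq_integral]

/-- The function `f` on `∂D` belongs to `H^{1/2}(∂D)`. -/
def MemHHalf (D : Set E3) (f : E3 → ℂ) : Prop :=
  ∃ u : HHalf D, HHalf.toL2 D u =ᵐ[surfaceMeasure D] f

open Classical in
/-- The duality pairing `⟨ψ, f⟩ = ∫_{∂D} f(y) ψ(y) dσ(y)` of `ψ ∈ H^{-1/2}(∂D)` with a function `f`
in `H^{1/2}(∂D)` (`0` if `f` is not in that space). -/
def pairing (D : Set E3) (ψ : HNegHalf D) (f : E3 → ℂ) : ℂ :=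
  if h : MemHHalf D f then ψ h.choose else 0

/-- For a density in `L²(∂D)` the duality pairing is the integral over `∂D`. -/
theorem pairing_ofL2 (D : Set E3) (g : Lp ℂ 2 (surfaceMeasure D)) (f : E3 → ℂ)
    (hf : MemHHalf D f) :
    pairing D (HNegHalf.ofL2 D g) f = ∫ y, f y * g y ∂(surfaceMeasure D) := by
  rw [pairing, dif_pos hf, HNegHalf.ofL2_apply]
  refine integral_congr_ae ?_
  filter_upwards [hf.choose_spec] with y hy
  rw [hy, mul_comm]

/-- The outgoing fundamental solution `Γ^k(x) = -e^{ik|x|} / (4π|x|)` of `Δ + k²`. -/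
def Gam (k : ℂ) (x : E3) : ℂ :=
  -(1 / (4 * (Real.pi : ℂ) * (‖x‖ : ℂ))) * Complex.exp (Complex.I * k * (‖x‖ : ℂ))

open Classical in
/-- The kernel `Γ₁^k` of the decomposition `Γ^k = Γ^0 - ik/(4π) + k² Γ₁^k`. At the removable
singularities `k = 0` and `x = 0` it has the limit values `|x|/(8π)` and `0`. -/
def Gam1 (k : ℂ) (x : E3) : ℂ :=
  if x = 0 then 0
  else if k = 0 then (‖x‖ : ℂ) / (8 * (Real.pi : ℂ))
  else (Gam k x - Gam 0 x + Complex.I * k / (4 * (Real.pi : ℂ))) / k ^ 2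

theorem Gam_decomposition (k : ℂ) {x : E3} (hx : x ≠ 0) :
    Gam k x = Gam 0 x - Complex.I * k / (4 * (Real.pi : ℂ)) + k ^ 2 * Gam1 k x := by
  by_cases hk : k = 0
  · simp [hk]
  · rw [Gam1, if_neg hx, if_neg hk]
    field_simp
    ring

/-- The value of `Γ₁^k` at `k = 0` is the limit of its values at `k ≠ 0`. -/
theorem tendsto_Gam1_zero (x : E3) :
    Filter.Tendsto (fun k => Gam1 k x) (𝓝[≠] 0) (𝓝 (Gam1 0 x)) := by
  by_cases hx : x = 0
  · simp [Gam1, hx]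
  have hr : 0 < ‖x‖ := norm_pos_iff.2 hx
  have hrC : (‖x‖ : ℂ) ≠ 0 := by exact_mod_cast hr.ne'
  have hpi : (Real.pi : ℂ) ≠ 0 := by exact_mod_cast Real.pi_ne_zero
  rw [tendsto_iff_norm_sub_tendsto_zero]
  have hlim : Filter.Tendsto
      (fun k : ℂ => ‖k‖ * (‖x‖ ^ 2 * Real.exp (‖k‖ * ‖x‖) / (4 * Real.pi))) (𝓝[≠] 0) (𝓝 0) := by
    have hc : Continuous
        (fun k : ℂ => ‖k‖ * (‖x‖ ^ 2 * Real.exp (‖k‖ * ‖x‖) / (4 * Real.pi))) := by fun_prop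
    have h := hc.tendsto 0
    simp only [norm_zero, zero_mul] at h
    exact h.mono_left nhdsWithin_le_nhds
  refine squeeze_zero' (Filter.Eventually.of_forall fun _ => norm_nonneg _) ?_ hlim
  filter_upwards [self_mem_nhdsWithin] with k hk
  have hk : k ≠ 0 := hk
  have hkp : 0 < ‖k‖ := norm_pos_iff.2 hk
  set w : ℂ := Complex.I * k * (‖x‖ : ℂ) with hw
  have hwn : ‖w‖ = ‖k‖ * ‖x‖ := by simp [hw]
  have hb := Complex.norm_exp_sub_sum_le_norm_mul_exp w 3
  have hw2 : w ^ 2 = -(k ^ 2 * (‖x‖ : ℂ) ^ 2) := by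
    rw [hw, mul_pow, mul_pow, Complex.I_sq]; ring
  have e : Gam1 k x - Gam1 0 x = -(1 / (4 * (Real.pi : ℂ) * (‖x‖ : ℂ) * k ^ 2)) *
      (Complex.exp w - ∑ m ∈ Finset.range 3, w ^ m / (m.factorial : ℂ)) := by
    have hs : ∑ m ∈ Finset.range 3, w ^ m / (m.factorial : ℂ) = 1 + w + w ^ 2 / 2 := by
      simp [Finset.sum_range_succ]
    rw [hs, hw2]
    simp only [Gam1, if_neg hx, if_neg hk, if_true, Gam, ← hw, mul_zero, zero_mul,
      Complex.exp_zero]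
    rw [hw]
    field_simp
    ring
  rw [e, norm_mul]
  have hn : ‖-(1 / (4 * (Real.pi : ℂ) * (‖x‖ : ℂ) * k ^ 2))‖ =
      1 / (4 * Real.pi * ‖x‖ * ‖k‖ ^ 2) := by
    simp [abs_of_pos Real.pi_pos]
  rw [hn]
  calc _ ≤ 1 / (4 * Real.pi * ‖x‖ * ‖k‖ ^ 2) * (‖w‖ ^ 3 * Real.exp ‖w‖) := by gcongr
    _ = _ := by
      rw [hwn]
      field_simp

/-- The normal derivative `∂Γ₁^k(x - y)/∂ν(x)`. -/
def dnGam1 (D : Set E3) (k : ℂ) (x y : E3) : ℂ :=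
  fderiv ℝ (Gam1 k) (x - y) (outwardNormal D x)

/-- `S₁^k[ψ](x) = ∫_{∂D} Γ₁^k(x - y) ψ(y) dσ(y)` for `ψ ∈ H^{-1/2}(∂D)`, as a duality pairing. -/
def singleLayer1 (D : Set E3) (k : ℂ) (ψ : HNegHalf D) (x : E3) : ℂ :=
  pairing D ψ fun y => Gam1 k (x - y)

/-- `K₁^{*,k}[ψ](x) = ∫_{∂D} ∂Γ₁^k(x - y)/∂ν(x) ψ(y) dσ(y)` for `ψ ∈ H^{-1/2}(∂D)`, as a duality
pairing. -/
def adjointDoubleLayer1 (D : Set E3) (k : ℂ) (ψ : HNegHalf D) (x : E3) : ℂ :=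
  pairing D ψ fun y => dnGam1 D k x y

end

/-!
The function `k ↦ Γ₁^k(x)` is entire, `Γ₁^k(x) = ∑ cₙ kⁿ |x|ⁿ⁺¹` with `cₙ = iⁿ / (4π (n + 2)!)`
(`hasSum_Gam1`, `hasSum_fderiv_Gam1`). So it is enough to show that the operators with the kernels
`|x - y|ⁿ⁺¹` and `|x - y|ⁿ ⟪ν(x), x - y⟫ / |x - y|` are compact, with norms that grow at most like
`n² Rⁿ`: the operator series then converges for every `k`, and its sum is analytic and compact.

Regard such a kernel `g` as the `H^{1/2}(∂D)`-valued function `G : x ↦ g(x, ·)`. The operator is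
`ψ ↦ ψ ∘ G`. If `G` is square-integrable as a Bochner function, this operator maps `H^{-1/2}(∂D)` to
`L²(∂D)` and is compact, because `G` is a limit of simple functions, for which the operator has
finite rank. If moreover `G(x) - G(x')` is square-integrable for the measure `|x - x'|⁻³ dσ dσ`,
the operator is compact into `H^{1/2}(∂D)` (`exists_compactOperator_L2`,
`exists_compactOperator_HHalf`).

The integrals are controlled by the single geometric fact that `∫ |x - y|^{-3/2} dσ(y)` is bounded
uniformly in `x`, a consequence of `σ(B(x, r)) ≤ C r²`, which holds since `∂D` is covered by
finitely many Lipschitz graphs (`IsBoundedLipschitzDomain.exists_lintegral_weight_le`). For a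
kernel that is bounded and satisfies `|g(x, y) - g(x, z)| ≤ B |y - z| / |x - y|`, interpolation
gives `|g(x, y) - g(x, z)|² ≤ C (|y - z| / |x - y|)^{3/2}`, which divided by `|y - z|³` is
integrable. For the single layer the double difference of `g` in both variables is at most
`B |x - x'| |y - z| / |x - y|`, by Ptolemy's inequality (`abs_norm_double_mul_le`), and interpolation
yields `‖G(x) - G(x')‖² ≤ C |x - x'|^{3/2}`.

Measurability of `G` reduces, by separability of `H^{1/2}(∂D)`, to that of the distances to fixed
elements; for the second kernel it also needs the Borel measurability of the normal, which follows
from the Lusin–Souslin theorem (`measurable_outwardNormal`).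
-/

/-! ### Upper Ahlfors regularity of the surface measure -/

theorem LipschitzOnWith.euclideanHausdorffMeasure_image_le {X Y : Type*} [EMetricSpace X]
    [MeasurableSpace X] [BorelSpace X] [EMetricSpace Y] [MeasurableSpace Y] [BorelSpace Y]
    {C : NNReal} {f : X → Y} {s : Set X} (h : LipschitzOnWith C f s) (d : ℕ) :
    (μHE[d] : Measure Y) (f '' s) ≤ (C : ENNReal) ^ d * (μHE[d] : Measure X) s := by
  have := h.hausdorffMeasure_image_le (d := d) (Nat.cast_nonneg d)
  rw [ENNReal.rpow_natCast] at this
  rw [Measure.euclideanHausdorffMeasure_def, Measure.euclideanHausdorffMeasure_def,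
    Measure.smul_apply, Measure.smul_apply, ENNReal.smul_def, ENNReal.smul_def, smul_eq_mul,
    smul_eq_mul, mul_left_comm]
  gcongr

theorem dist_firstTwo_le (a b : E3) :
    dist (!₂[a 0, a 1] : EuclideanSpace ℝ (Fin 2)) !₂[b 0, b 1] ≤ dist a b := by
  rw [EuclideanSpace.dist_eq, EuclideanSpace.dist_eq]
  apply Real.sqrt_le_sqrt
  simp only [Fin.sum_univ_two, Fin.sum_univ_three]
  simp

theorem lipschitzWith_graph {φ : EuclideanSpace ℝ (Fin 2) → ℝ} {C : NNReal}
    (hφ : LipschitzWith C φ) :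
    LipschitzWith (1 + C) (fun u : EuclideanSpace ℝ (Fin 2) => (!₂[u 0, u 1, φ u] : E3)) := by
  refine LipschitzWith.of_dist_le_mul fun u v => ?_
  have h := hφ.dist_le_mul u v
  have h0 : (0 : ℝ) ≤ C := C.2
  rw [EuclideanSpace.dist_eq]
  refine Real.sqrt_le_iff.2 ⟨by positivity, ?_⟩
  have h2 : dist u v ^ 2 = dist (u 0) (v 0) ^ 2 + dist (u 1) (v 1) ^ 2 := by
    rw [EuclideanSpace.dist_eq, Real.sq_sqrt (by positivity), Fin.sum_univ_two]
  simp only [Fin.sum_univ_three]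
  simp only [Matrix.cons_val_zero, Matrix.cons_val_one, Matrix.cons_val]
  rw [← h2]
  push_cast
  have h3 : dist (φ u) (φ v) ^ 2 ≤ (C * dist u v) ^ 2 := by gcongr
  nlinarith [mul_nonneg h0 (sq_nonneg (dist u v))]

/-- Near a boundary point, the boundary lies on the Lipschitz graph that describes the domain. -/
theorem IsBoundedLipschitzDomain.mem_graph {D : Set E3} (hD : IsBoundedLipschitzDomain D)
    {x : E3} {r : ℝ} {L : E3 ≃ₗᵢ[ℝ] E3} {φ : EuclideanSpace ℝ (Fin 2) → ℝ} (hφ : Continuous φ)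
    (h : ∀ y ∈ Metric.ball x r, y ∈ D ↔ φ !₂[L y 0, L y 1] < L y 2)
    {y : E3} (hy : y ∈ frontier D) (hyr : y ∈ Metric.ball x r) :
    φ !₂[L y 0, L y 1] = L y 2 := by
  have hyD : y ∉ D := by
    rw [hD.isOpen.frontier_eq] at hy
    exact hy.2
  have h1 : L y 2 ≤ φ !₂[L y 0, L y 1] := not_lt.1 fun hlt => hyD ((h y hyr).2 hlt)
  refine le_antisymm ?_ h1
  have hc : Continuous fun y : E3 => φ !₂[L y 0, L y 1] := by fun_prop
  have hc2 : Continuous fun y : E3 => L y 2 := by fun_prop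
  by_contra hlt
  have hlt := not_le.1 hlt
  have hev : ∀ᶠ z in 𝓝 y, L z 2 < φ !₂[L z 0, L z 1] :=
    hc2.continuousAt.eventually_lt hc.continuousAt hlt
  have hev2 := hev.and (Metric.isOpen_ball.mem_nhds hyr)
  have hcl : y ∈ closure D := frontier_subset_closure hy
  obtain ⟨z, hzD, hz1, hz2⟩ := ((mem_closure_iff_frequently.1 hcl).and_eventually hev2).exists
  exact absurd ((h z hz2).1 hzD) (not_lt.2 hz1.le)

/-- The surface measure of a ball of radius `r` is at most a constant times `r ^ 2`. -/
theorem IsBoundedLipschitzDomain.exists_surfaceMeasure_ball_le {D : Set E3}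
    (hD : IsBoundedLipschitzDomain D) :
    ∃ C : NNReal, ∀ (p : E3) (r : ℝ), 0 < r →
      surfaceMeasure D (Metric.ball p r) ≤ C * ENNReal.ofReal (r ^ 2) := by
  have hcomp : IsCompact (frontier D) :=
    Metric.isCompact_of_isClosed_isBounded isClosed_frontier
      (hD.isBounded.closure.subset frontier_subset_closure)
  have hloc : ∀ x ∈ frontier D, ∃ t ∈ 𝓝[frontier D] x, ∃ C : NNReal, ∀ (p : E3) (r : ℝ), 0 < r →
      (μHE[2] : Measure E3) (t ∩ frontier D ∩ Metric.ball p r) ≤ C * ENNReal.ofReal (r ^ 2) := by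
    intro x hx
    obtain ⟨δ, hδ, L, C, φ, hφ, h⟩ := hD.lipschitz_boundary x hx
    refine ⟨Metric.ball x δ, mem_nhdsWithin_of_mem_nhds (Metric.ball_mem_nhds x hδ),
      (1 + C) ^ 2 * (volume (Metric.ball (0 : EuclideanSpace ℝ (Fin 2)) 1)).toNNReal, ?_⟩
    intro p r hr
    set Φ : EuclideanSpace ℝ (Fin 2) → E3 := fun u => L.symm !₂[u 0, u 1, φ u]
    have hΦl : LipschitzWith (1 + C) Φ := by
      have := L.symm.lipschitz.comp (lipschitzWith_graph hφ)
      rwa [one_mul] at this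
    have hsub : Metric.ball x δ ∩ frontier D ∩ Metric.ball p r ⊆
        Φ '' Metric.ball !₂[L p 0, L p 1] r := by
      rintro y ⟨⟨hy1, hy2⟩, hy3⟩
      refine ⟨!₂[L y 0, L y 1], ?_, ?_⟩
      · refine lt_of_le_of_lt (dist_firstTwo_le (L y) (L p)) ?_
        rw [L.dist_map]
        exact hy3
      · have hg := hD.mem_graph hφ.continuous h hy2 hy1
        simp only [Φ]
        rw [LinearIsometryEquiv.symm_apply_eq]
        ext i
        fin_cases i
        · simp
        · simp
        · simpa using hg
    calc _ ≤ (μHE[2] : Measure E3) (Φ '' Metric.ball !₂[L p 0, L p 1] r) := measure_mono hsub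
      _ ≤ ((1 + C : NNReal) : ENNReal) ^ 2 * (μHE[2] : Measure (EuclideanSpace ℝ (Fin 2)))
          (Metric.ball !₂[L p 0, L p 1] r) :=
        hΦl.lipschitzOnWith.euclideanHausdorffMeasure_image_le 2
      _ = _ := by
        rw [EuclideanSpace.euclideanHausdorffMeasure_eq_volume, Measure.addHaar_ball _ _ hr.le,
          finrank_euclideanSpace_fin]
        push_cast
        rw [ENNReal.coe_toNNReal (measure_ball_lt_top).ne]
        ring
  have hind := hcomp.induction_on
    (p := fun s => ∃ C : NNReal, ∀ (p : E3) (r : ℝ), 0 < r →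
      (μHE[2] : Measure E3) (s ∩ frontier D ∩ Metric.ball p r) ≤ C * ENNReal.ofReal (r ^ 2))
    ⟨0, by simp⟩
    (by
      rintro s t hst ⟨C, hC⟩
      exact ⟨C, fun p r hr => (measure_mono (by gcongr)).trans (hC p r hr)⟩)
    (by
      rintro s t ⟨C, hC⟩ ⟨C', hC'⟩
      refine ⟨C + C', fun p r hr => ?_⟩
      rw [Set.union_inter_distrib_right, Set.union_inter_distrib_right]
      refine (measure_union_le _ _).trans ((add_le_add (hC p r hr) (hC' p r hr)).trans ?_)
      push_cast
      rw [add_mul])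
    hloc
  obtain ⟨C, hC⟩ := hind
  refine ⟨C, fun p r hr => ?_⟩
  rw [surfaceMeasure, Measure.restrict_apply Metric.isOpen_ball.measurableSet, Set.inter_comm]
  simpa using hC p r hr

theorem IsBoundedLipschitzDomain.isFiniteMeasure_surfaceMeasure {D : Set E3}
    (hD : IsBoundedLipschitzDomain D) : IsFiniteMeasure (surfaceMeasure D) := by
  obtain ⟨C, hC⟩ := hD.exists_surfaceMeasure_ball_le
  obtain ⟨R, hR, hsub⟩ := (hD.isBounded.closure.subset
    frontier_subset_closure).subset_ball_lt 0 (0 : E3)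
  constructor
  have h1 : surfaceMeasure D Set.univ ≤ surfaceMeasure D (Metric.ball 0 R) := by
    rw [surfaceMeasure, Measure.restrict_apply_univ,
      Measure.restrict_apply Metric.isOpen_ball.measurableSet]
    exact measure_mono fun y hy => ⟨hsub hy, hy⟩
  refine (h1.trans (hC 0 R hR)).trans_lt ?_
  exact ENNReal.mul_lt_top ENNReal.coe_lt_top ENNReal.ofReal_lt_top

theorem IsBoundedLipschitzDomain.exists_diameter_bound {D : Set E3}
    (hD : IsBoundedLipschitzDomain D) :
    ∃ R : ℝ, 1 ≤ R ∧ ∀ x ∈ frontier D, ∀ y ∈ frontier D, ‖x - y‖ ≤ R := by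
  obtain ⟨C, hC⟩ := Metric.isBounded_iff.1 (hD.isBounded.closure.subset frontier_subset_closure)
  exact ⟨max 1 C, le_max_left _ _, fun x hx y hy => by
    rw [← dist_eq_norm]; exact (hC hx hy).trans (le_max_right _ _)⟩

/-- The weight `t ↦ t ^ (-3/2)`, with the value `∞` for `t ≤ 0`. -/
noncomputable def weight (t : ℝ) : ENNReal := (ENNReal.ofReal (√t ^ 3))⁻¹

theorem measurable_weight : Measurable weight := by
  unfold weight
  fun_prop

theorem weight_sq {t : ℝ} (ht : 0 ≤ t) : weight t ^ 2 = (ENNReal.ofReal (t ^ 3))⁻¹ := by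
  rw [weight, ← ENNReal.inv_pow, ← ENNReal.ofReal_pow (by positivity), ← pow_mul, mul_comm, pow_mul,
    Real.sq_sqrt ht]

/-- A dyadic majorant of the weight. Radii are powers of `1 / 4`, so that the weight at those radii
is a power of `8`; the sum is infinite at `t = 0`, as the weight is. -/
theorem weight_le_tsum {t : ℝ} (ht : 0 ≤ t) :
    weight t ≤ 1 + ∑' j : ℕ, if t ≤ (1 / 4) ^ j then (8 : ENNReal) ^ (j + 1) else 0 := by
  rcases le_or_gt 1 t with h1 | h1
  · refine le_add_right ?_
    rw [weight, ENNReal.inv_le_one, ← ENNReal.ofReal_one]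
    exact ENNReal.ofReal_le_ofReal (one_le_pow₀ (Real.one_le_sqrt.2 h1))
  refine le_add_left ?_
  rcases ht.eq_or_lt with rfl | ht
  · refine le_top.trans ?_
    rw [← ENNReal.tsum_const_eq_top_of_ne_zero (α := ℕ) one_ne_zero]
    refine ENNReal.tsum_le_tsum fun j => ?_
    rw [if_pos (by positivity)]
    exact one_le_pow₀ (by norm_num)
  · obtain ⟨j, hj1, hj2⟩ := exists_nat_pow_near_of_lt_one ht h1.le (by norm_num : (0 : ℝ) < 1 / 4)
      (by norm_num)
    refine le_trans ?_ (ENNReal.le_tsum j)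
    rw [if_pos hj2, weight, ENNReal.inv_le_iff_inv_le, ENNReal.inv_pow]
    have h2 : (1 / 2 : ℝ) ^ (j + 1) ≤ √t := by
      refine Real.le_sqrt_of_sq_le ?_
      rw [← pow_mul, mul_comm, pow_mul]
      norm_num at hj1 ⊢
      exact hj1.le
    have h3 : (1 / 8 : ℝ) ^ (j + 1) ≤ √t ^ 3 := by
      calc (1 / 8 : ℝ) ^ (j + 1) = ((1 / 2 : ℝ) ^ (j + 1)) ^ 3 := by
            rw [← pow_mul, mul_comm, pow_mul]; norm_num
        _ ≤ _ := by gcongr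
    refine le_trans (le_of_eq ?_) (ENNReal.ofReal_le_ofReal h3)
    rw [ENNReal.ofReal_pow (by norm_num), one_div, ENNReal.ofReal_inv_of_pos (by norm_num)]
    norm_num

/-- The kernel `|x - y| ^ (-3/2)` is integrable on the boundary, uniformly in `x`. -/
theorem IsBoundedLipschitzDomain.exists_lintegral_weight_le {D : Set E3}
    (hD : IsBoundedLipschitzDomain D) :
    ∃ A : NNReal, ∀ x : E3, ∫⁻ y, weight ‖x - y‖ ∂surfaceMeasure D ≤ A := by
  obtain ⟨C, hC⟩ := hD.exists_surfaceMeasure_ball_le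
  have := hD.isFiniteMeasure_surfaceMeasure
  have hball : ∀ (x : E3) (j : ℕ), surfaceMeasure D {y | ‖x - y‖ ≤ (1 / 4) ^ j} ≤
      C * (4 * (16⁻¹) ^ j) := by
    intro x j
    have hpos : (0 : ℝ) < (1 / 4) ^ j := by positivity
    have hsub : {y : E3 | ‖x - y‖ ≤ (1 / 4) ^ j} ⊆ Metric.ball x (2 * (1 / 4) ^ j) := by
      intro y hy
      rw [Metric.mem_ball, dist_comm, dist_eq_norm]
      have hy : ‖x - y‖ ≤ (1 / 4) ^ j := hy
      linarith
    refine (measure_mono hsub).trans ((hC x _ (by positivity)).trans (le_of_eq ?_))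
    have e : (2 * (1 / 4 : ℝ) ^ j) ^ 2 = 4 * (16⁻¹) ^ j := by
      rw [mul_pow, ← pow_mul, mul_comm j, pow_mul]; norm_num
    rw [e, ENNReal.ofReal_mul (by norm_num), ENNReal.ofReal_pow (by norm_num),
      ENNReal.ofReal_inv_of_pos (by norm_num)]
    norm_num
  set B : ENNReal := surfaceMeasure D Set.univ + 32 * C * (1 - 2⁻¹)⁻¹ with hB
  have hBtop : B ≠ ⊤ := by
    refine ENNReal.add_ne_top.2 ⟨measure_ne_top _ _, ENNReal.mul_ne_top (by finiteness) ?_⟩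
    rw [ENNReal.one_sub_inv_two, inv_inv]
    finiteness
  refine ⟨B.toNNReal, fun x => ?_⟩
  rw [ENNReal.coe_toNNReal hBtop]
  have hmeas : ∀ j : ℕ, MeasurableSet {y : E3 | ‖x - y‖ ≤ (1 / 4) ^ j} := fun j =>
    (isClosed_le (by fun_prop) continuous_const).measurableSet
  calc ∫⁻ y, weight ‖x - y‖ ∂surfaceMeasure D
      ≤ ∫⁻ y, (1 + ∑' j : ℕ, {y : E3 | ‖x - y‖ ≤ (1 / 4) ^ j}.indicator
          (fun _ => (8 : ENNReal) ^ (j + 1)) y) ∂surfaceMeasure D := by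
        refine lintegral_mono fun y => ?_
        simpa [Set.indicator_apply] using weight_le_tsum (norm_nonneg (x - y))
    _ = surfaceMeasure D Set.univ + ∑' j : ℕ, (8 : ENNReal) ^ (j + 1) *
          surfaceMeasure D {y | ‖x - y‖ ≤ (1 / 4) ^ j} := by
        rw [lintegral_add_left measurable_const, lintegral_one, lintegral_tsum
          fun j => (measurable_const.indicator (hmeas j)).aemeasurable]
        congr 2 with j
        rw [lintegral_indicator_const (hmeas j)]
    _ ≤ surfaceMeasure D Set.univ + ∑' j : ℕ, (32 * C * (2⁻¹) ^ j : ENNReal) := by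
        refine add_le_add_right (ENNReal.tsum_le_tsum fun j => ?_) _
        refine (mul_le_mul_right (hball x j) _).trans (le_of_eq ?_)
        have e : (8 : ENNReal) ^ j * (16⁻¹) ^ j = (2⁻¹) ^ j := by
          rw [← mul_pow]
          congr 1
          rw [show (16 : ENNReal) = 8 * 2 by norm_num, ENNReal.mul_inv (by norm_num) (by norm_num),
            ← mul_assoc, ENNReal.mul_inv_cancel (by norm_num) (by norm_num), one_mul]
        rw [← e]
        ring
    _ = B := by rw [ENNReal.tsum_mul_left, ENNReal.tsum_geometric, hB]

/-! ### The space `H^{1/2}(∂D)` -/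

instance slobodeckijMeasure.instSFinite (D : Set E3) [SFinite (surfaceMeasure D)] :
    SFinite (slobodeckijMeasure D) := by
  unfold slobodeckijMeasure
  infer_instance

theorem slobodeckijMeasure_absolutelyContinuous (D : Set E3) :
    slobodeckijMeasure D ≪ (surfaceMeasure D).prod (surfaceMeasure D) :=
  withDensity_absolutelyContinuous _ _

theorem lintegral_slobodeckijMeasure (D : Set E3) [SFinite (surfaceMeasure D)]
    {f : E3 × E3 → ENNReal} (hf : Measurable f) :
    ∫⁻ p, f p ∂slobodeckijMeasure D =
      ∫⁻ x, ∫⁻ y, weight ‖x - y‖ ^ 2 * f (x, y) ∂surfaceMeasure D ∂surfaceMeasure D := by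
  have hw : Measurable fun p : E3 × E3 => (ENNReal.ofReal (‖p.1 - p.2‖ ^ 3))⁻¹ := by fun_prop
  rw [slobodeckijMeasure, lintegral_withDensity_eq_lintegral_mul _ hw hf,
    lintegral_prod _ (hw.mul hf).aemeasurable]
  simp only [Pi.mul_apply, weight_sq (norm_nonneg _)]

theorem ae_slobodeckijMeasure_of_ae {D : Set E3} [SFinite (surfaceMeasure D)] {p : E3 → Prop}
    (h : ∀ᵐ x ∂surfaceMeasure D, p x) : ∀ᵐ q ∂slobodeckijMeasure D, p q.1 ∧ p q.2 := by
  refine (slobodeckijMeasure_absolutelyContinuous D).ae_le ?_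
  exact (Measure.quasiMeasurePreserving_fst.ae h).and (Measure.quasiMeasurePreserving_snd.ae h)

/-- The second component of an element of `H^{1/2}(∂D)` is determined by the first, whichever
representative of the first is used. -/
theorem HHalf.snd_ae_eq {D : Set E3} [SFinite (surfaceMeasure D)] (u : HHalf D) {f : E3 → ℂ}
    (hf : HHalf.toL2 D u =ᵐ[surfaceMeasure D] f) :
    u.1.snd =ᵐ[slobodeckijMeasure D] fun p => f p.1 - f p.2 := by
  obtain ⟨g, hg, hg'⟩ := u.2
  filter_upwards [hg', ae_slobodeckijMeasure_of_ae (hg.symm.trans hf)] with p hp hp2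
  rw [hp, hp2.1, hp2.2]

theorem HHalf.toL2_injective (D : Set E3) [SFinite (surfaceMeasure D)] :
    Function.Injective (HHalf.toL2 D) := by
  intro u v h
  refine Subtype.ext (WithLp.ofLp_injective _ (Prod.ext h (Lp.ext ?_)))
  have h1 := u.snd_ae_eq (Filter.EventuallyEq.refl _ _)
  rw [h] at h1
  exact h1.trans (v.snd_ae_eq (Filter.EventuallyEq.refl _ _)).symm

/-- The pairing does not depend on the element of `H^{1/2}(∂D)` chosen to represent the function. -/
theorem pairing_eq {D : Set E3} [SFinite (surfaceMeasure D)] (ψ : HNegHalf D) (u : HHalf D)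
    {f : E3 → ℂ} (hf : HHalf.toL2 D u =ᵐ[surfaceMeasure D] f) : pairing D ψ f = ψ u := by
  have h : MemHHalf D f := ⟨u, hf⟩
  rw [pairing, dif_pos h]
  congr 1
  exact HHalf.toL2_injective D (Lp.ext (h.choose_spec.trans hf.symm))

/-- The squared `H^{1/2}(∂D)` norm of a function, as an extended nonnegative number. -/
noncomputable def slobodeckijEnergy (D : Set E3) (f : E3 → ℂ) : ENNReal :=
  ∫⁻ y, ‖f y‖ₑ ^ 2 ∂surfaceMeasure D + ∫⁻ p, ‖f p.1 - f p.2‖ₑ ^ 2 ∂slobodeckijMeasure D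

theorem eLpNorm_two_sq {α E : Type*} {m : MeasurableSpace α} [NormedAddCommGroup E]
    (μ : Measure α) (f : α → E) :
    eLpNorm f 2 μ ^ 2 = ∫⁻ x, ‖f x‖ₑ ^ 2 ∂μ := by
  have := eLpNorm_nnreal_pow_eq_lintegral (μ := μ) (f := f) (p := 2) (by norm_num)
  simpa using this

theorem HHalf.enorm_sq_eq {D : Set E3} [SFinite (surfaceMeasure D)] (u : HHalf D) {f : E3 → ℂ}
    (hf : HHalf.toL2 D u =ᵐ[surfaceMeasure D] f) : ‖u‖ₑ ^ 2 = slobodeckijEnergy D f := by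
  have h1 : ‖u‖ₑ = ENNReal.ofReal ‖u.1‖ := (ofReal_norm u).symm
  rw [h1, ← ENNReal.ofReal_pow (norm_nonneg _), WithLp.prod_norm_sq_eq_of_L2,
    ENNReal.ofReal_add (by positivity) (by positivity), ENNReal.ofReal_pow (norm_nonneg _),
    ENNReal.ofReal_pow (norm_nonneg _), ofReal_norm, ofReal_norm, Lp.enorm_def, Lp.enorm_def,
    slobodeckijEnergy, ← eLpNorm_two_sq, ← eLpNorm_two_sq (slobodeckijMeasure D)]
  congr 2
  · exact eLpNorm_congr_ae hf
  · exact eLpNorm_congr_ae (u.snd_ae_eq hf)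

theorem memHHalf_of_slobodeckijEnergy_ne_top {D : Set E3} [SFinite (surfaceMeasure D)] {f : E3 → ℂ}
    (hf : Measurable f) (h : slobodeckijEnergy D f ≠ ⊤) : MemHHalf D f := by
  have h' := ENNReal.add_ne_top.1 h
  have h1 : MemLp f 2 (surfaceMeasure D) := by
    refine ⟨hf.aestronglyMeasurable, lt_top_iff_ne_top.2 fun ht => h'.1 ?_⟩
    rw [← eLpNorm_two_sq, ht]
    rfl
  have h2 : MemLp (fun p : E3 × E3 => f p.1 - f p.2) 2 (slobodeckijMeasure D) := by
    refine ⟨(by fun_prop : Measurable fun p : E3 × E3 => f p.1 - f p.2).aestronglyMeasurable,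
      lt_top_iff_ne_top.2 fun ht => h'.2 ?_⟩
    rw [← eLpNorm_two_sq (slobodeckijMeasure D), ht]
    rfl
  exact ⟨⟨WithLp.toLp 2 (h1.toLp f, h2.toLp _), f, h1.coeFn_toLp, h2.coeFn_toLp⟩, h1.coeFn_toLp⟩

/-- Pass to almost everywhere convergent subsequences of both components: the relation between them
is preserved by pointwise limits. -/
theorem isClosed_HHalfSubmodule (D : Set E3) [SFinite (surfaceMeasure D)] :
    IsClosed (HHalfSubmodule D : Set
      (WithLp 2 (Lp ℂ 2 (surfaceMeasure D) × Lp ℂ 2 (slobodeckijMeasure D)))) := by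
  refine IsSeqClosed.isClosed fun u v hu huv => ?_
  have h1 : Filter.Tendsto (fun n => (u n).fst) Filter.atTop (𝓝 v.fst) :=
    ((WithLp.fstL 2 ℂ _ _).continuous.tendsto v).comp huv
  have h2 : Filter.Tendsto (fun n => (u n).snd) Filter.atTop (𝓝 v.snd) :=
    ((WithLp.sndL 2 ℂ _ _).continuous.tendsto v).comp huv
  obtain ⟨a, ha, hae⟩ := (tendstoInMeasure_of_tendsto_Lp h1).exists_seq_tendsto_ae
  obtain ⟨b, hb, hbe⟩ := (tendstoInMeasure_of_tendsto_Lp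
    (h2.comp ha.tendsto_atTop)).exists_seq_tendsto_ae
  refine ⟨v.fst, Filter.EventuallyEq.refl _ _, ?_⟩
  have h3 : ∀ᵐ p ∂slobodeckijMeasure D, ∀ n, (u n).snd p = (u n).fst p.1 - (u n).fst p.2 :=
    ae_all_iff.2 fun n =>
      HHalf.snd_ae_eq (⟨u n, hu n⟩ : HHalfSubmodule D) (Filter.EventuallyEq.refl _ _)
  filter_upwards [hbe, h3, ae_slobodeckijMeasure_of_ae hae] with p hp hp3 hpa
  refine tendsto_nhds_unique hp ?_
  simp only [Function.comp_apply, hp3]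
  exact (hpa.1.sub hpa.2).comp hb.tendsto_atTop

instance HHalf.instCompleteSpace (D : Set E3) [SFinite (surfaceMeasure D)] :
    CompleteSpace (HHalf D) :=
  (isClosed_HHalfSubmodule D).completeSpace_coe

instance HHalf.instSecondCountableTopology (D : Set E3) [SFinite (surfaceMeasure D)] :
    SecondCountableTopology (HHalf D) := by
  have : Fact ((2 : ENNReal) ≠ ⊤) := ⟨by norm_num⟩
  exact inferInstanceAs (SecondCountableTopology (HHalfSubmodule D))

/-- A map into a separable metric space is strongly measurable as soon as the distance to each
point depends measurably on the argument. -/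
theorem stronglyMeasurable_of_measurable_edist {α X : Type*} [MeasurableSpace α]
    [PseudoMetricSpace X] [SecondCountableTopology X] {f : α → X}
    (h : ∀ u, Measurable fun x => edist (f x) u) : StronglyMeasurable f := by
  borelize X
  refine Measurable.stronglyMeasurable ?_
  have hb : TopologicalSpace.IsTopologicalBasis
      {s : Set X | ∃ (u : X) (r : ENNReal), s = Metric.eball u r} := by
    refine TopologicalSpace.isTopologicalBasis_of_isOpen_of_nhds ?_ ?_
    · rintro _ ⟨u, r, rfl⟩
      exact Metric.isOpen_eball
    · intro a s ha hs
      obtain ⟨r, hr, hrs⟩ := EMetric.mem_nhds_iff.1 (hs.mem_nhds ha)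
      exact ⟨_, ⟨a, r, rfl⟩, Metric.mem_eball_self hr, hrs⟩
  rw [‹BorelSpace X›.measurable_eq, hb.borel_eq_generateFrom]
  refine measurable_generateFrom ?_
  rintro _ ⟨u, r, rfl⟩
  exact h u measurableSet_Iio

/-- A family of elements of `H^{1/2}(∂D)` given by a jointly measurable kernel is strongly
measurable. -/
theorem HHalf.aestronglyMeasurable_of_kernel {D : Set E3} [SFinite (surfaceMeasure D)]
    {g : E3 → E3 → ℂ} (hg : Measurable (Function.uncurry g)) {G : E3 → HHalf D}
    (hG : ∀ x ∈ frontier D, HHalf.toL2 D (G x) =ᵐ[surfaceMeasure D] g x) :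
    AEStronglyMeasurable G (surfaceMeasure D) := by
  have hF : MeasurableSet (frontier D) := isClosed_frontier.measurableSet
  rw [surfaceMeasure, ← aestronglyMeasurable_indicator_iff hF]
  -- The squared distance to a fixed element is an energy integral with a parameter, hence
  -- measurable in the parameter by Tonelli's theorem.
  refine (stronglyMeasurable_of_measurable_edist fun u => ?_).aestronglyMeasurable
  have hu : Measurable (HHalf.toL2 D u) := (Lp.stronglyMeasurable _).measurable
  set g' : E3 → E3 → ℂ := fun x => (frontier D).indicator (fun x => g x) x with hg'
  have hg'm : Measurable (Function.uncurry g') := by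
    have : Function.uncurry g' = (frontier D ×ˢ Set.univ).indicator (Function.uncurry g) := by
      ext ⟨x, y⟩
      by_cases hx : x ∈ frontier D <;> simp [hg', hx]
    rw [this]
    exact hg.indicator (hF.prod .univ)
  have he : ∀ x, edist ((frontier D).indicator G x) u ^ 2 =
      slobodeckijEnergy D (fun y => g' x y - HHalf.toL2 D u y) := by
    intro x
    rw [edist_eq_enorm_sub]
    refine HHalf.enorm_sq_eq _ ?_
    rw [map_sub]
    refine (Lp.coeFn_sub _ _).trans (Filter.EventuallyEq.sub ?_ (Filter.EventuallyEq.refl _ _))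
    by_cases hx : x ∈ frontier D
    · simpa [hg', hx] using hG x hx
    · simp only [hg', hx, not_false_eq_true, Set.indicator_of_notMem, map_zero]
      exact Lp.coeFn_zero _ _ _
  have hm : Measurable fun x => edist ((frontier D).indicator G x) u ^ 2 := by
    simp_rw [he]
    refine Measurable.add ?_ ?_
    · refine Measurable.lintegral_prod_right' (f := fun p : E3 × E3 =>
        ‖g' p.1 p.2 - HHalf.toL2 D u p.2‖ₑ ^ 2) ?_
      exact ((hg'm.sub (hu.comp measurable_snd)).enorm).pow_const 2
    · refine Measurable.lintegral_prod_right' (f := fun p : E3 × (E3 × E3) =>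
        ‖g' p.1 p.2.1 - HHalf.toL2 D u p.2.1 - (g' p.1 p.2.2 - HHalf.toL2 D u p.2.2)‖ₑ ^ 2) ?_
      have h1 : Measurable fun p : E3 × (E3 × E3) => g' p.1 p.2.1 :=
        hg'm.comp (by fun_prop : Measurable fun p : E3 × (E3 × E3) => (p.1, p.2.1))
      have h2 : Measurable fun p : E3 × (E3 × E3) => g' p.1 p.2.2 :=
        hg'm.comp (by fun_prop : Measurable fun p : E3 × (E3 × E3) => (p.1, p.2.2))
      exact (((h1.sub (by fun_prop)).sub (h2.sub (by fun_prop))).enorm).pow_const 2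
  -- a measurable square in `[0, ∞]` has a measurable root
  have e : (fun x => edist ((frontier D).indicator G x) u) =
      fun x => (edist ((frontier D).indicator G x) u ^ 2) ^ (1 / 2 : ℝ) := by
    ext x
    rw [← ENNReal.rpow_natCast, ← ENNReal.rpow_mul]
    norm_num
  rw [e]
  exact hm.pow_const (1 / 2 : ℝ)

/-! ### Compact operators given by square-integrable vector-valued kernels -/

section
variable {α H : Type*} {m : MeasurableSpace α} [NormedAddCommGroup H] [NormedSpace ℂ H]

/-- For `F ∈ Lᵖ(μ; H)`, the operator `H' → Lᵖ(μ)` that sends `ψ` to `x ↦ ψ (F x)`. -/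
noncomputable def dualCompLp {μ : Measure α} {p : ENNReal} [Fact (1 ≤ p)] (F : Lp H p μ) :
    (H →L[ℂ] ℂ) →L[ℂ] Lp ℂ p μ :=
  ((ContinuousLinearMap.id ℂ (H →L[ℂ] ℂ)).compLpL₂ p μ).flip F

theorem dualCompLp_apply {μ : Measure α} {p : ENNReal} [Fact (1 ≤ p)] (F : Lp H p μ)
    (ψ : H →L[ℂ] ℂ) : dualCompLp F ψ = ψ.compLp F := rfl

/-- For a simple function `F` the operator has finite rank; simple functions are dense and the
compact operators are closed in the operator norm. -/
theorem isCompactOperator_dualCompLp {μ : Measure α} {p : ENNReal} [Fact (1 ≤ p)] (hp : p ≠ ⊤)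
    (F : Lp H p μ) : IsCompactOperator (dualCompLp F) := by
  induction F using Lp.induction hp with
  | @indicatorConst c s hs hμs =>
    set e : Lp ℂ p μ := indicatorConstLp p hs hμs.ne 1
    have h : dualCompLp (Lp.simpleFunc.indicatorConst p hs hμs.ne c : Lp H p μ) =
        (ContinuousLinearMap.toSpanSingleton ℂ e).comp (ContinuousLinearMap.apply ℂ ℂ c) := by
      ext1 ψ
      rw [dualCompLp_apply, Lp.simpleFunc.coe_indicatorConst]
      refine Lp.ext ?_
      simp only [ContinuousLinearMap.comp_apply, ContinuousLinearMap.toSpanSingleton_apply,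
        ContinuousLinearMap.apply_apply]
      filter_upwards [ψ.coeFn_compLp (indicatorConstLp p hs hμs.ne c),
        Lp.coeFn_smul (ψ c) e, indicatorConstLp_coeFn (p := p) (hs := hs) (hμs := hμs.ne) (c := c),
        indicatorConstLp_coeFn (p := p) (hs := hs) (hμs := hμs.ne) (c := (1 : ℂ))]
        with x h1 h2 h3 h4
      rw [h1, h2, h3, Pi.smul_apply, h4]
      by_cases hx : x ∈ s <;> simp [Set.indicator, hx]
    rw [h]
    exact (isCompactOperator_of_locallyCompactSpace_rng
      (ContinuousLinearMap.toSpanSingleton ℂ e)).comp_clm (ContinuousLinearMap.apply ℂ ℂ c)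
  | add hf hg _ ihf ihg =>
    rw [dualCompLp, map_add]
    exact ihf.add ihg
  | isClosed =>
    exact isClosed_setOfPred_isCompactOperator.preimage
      (((ContinuousLinearMap.id ℂ (H →L[ℂ] ℂ)).compLpL₂ p μ).flip).continuous

theorem norm_dualCompLp_apply_le {μ : Measure α} {p : ENNReal} [Fact (1 ≤ p)] (F : Lp H p μ)
    (ψ : H →L[ℂ] ℂ) : ‖dualCompLp F ψ‖ ≤ ‖F‖ * ‖ψ‖ := by
  rw [dualCompLp_apply, mul_comm]
  exact ψ.norm_compLp_le F

/-- A square-integrable `H`-valued function `G` gives a compact operator `ψ ↦ ψ ∘ G` from the dual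
of `H` to `L²`. -/
theorem exists_compactOperator_L2 {μ : Measure α} {G : α → H} (hG : MemLp G 2 μ) :
    ∃ T : (H →L[ℂ] ℂ) →L[ℂ] Lp ℂ 2 μ, IsCompactOperator T ∧
      ‖T‖ ≤ (eLpNorm G 2 μ).toReal ∧ ∀ ψ, T ψ =ᵐ[μ] fun x => ψ (G x) := by
  refine ⟨dualCompLp (hG.toLp G), isCompactOperator_dualCompLp (by norm_num) _, ?_, fun ψ => ?_⟩
  · refine ContinuousLinearMap.opNorm_le_bound _ ENNReal.toReal_nonneg fun ψ => ?_
    rw [← Lp.norm_toLp G hG]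
    exact norm_dualCompLp_apply_le _ ψ
  · rw [dualCompLp_apply]
    filter_upwards [ψ.coeFn_compLp (hG.toLp G), hG.coeFn_toLp] with x h1 h2
    rw [h1, h2]

/-- If `G` is square-integrable and `G x - G y` is square-integrable for `|x - y|⁻³ dσ dσ`, that
is, if `G ∈ H^{1/2}(∂D; H)`, then `ψ ↦ ψ ∘ G` is a compact operator from the dual of `H` to
`H^{1/2}(∂D)`. -/
theorem exists_compactOperator_HHalf {D : Set E3} [SFinite (surfaceMeasure D)] {G : E3 → H}
    (hG : MemLp G 2 (surfaceMeasure D))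
    (hG' : MemLp (fun p : E3 × E3 => G p.1 - G p.2) 2 (slobodeckijMeasure D)) :
    ∃ T : (H →L[ℂ] ℂ) →L[ℂ] HHalf D, IsCompactOperator T ∧
      ‖T‖ ≤ (eLpNorm G 2 (surfaceMeasure D)).toReal +
        (eLpNorm (fun p : E3 × E3 => G p.1 - G p.2) 2 (slobodeckijMeasure D)).toReal ∧
      ∀ ψ, HHalf.toL2 D (T ψ) =ᵐ[surfaceMeasure D] fun x => ψ (G x) := by
  obtain ⟨T₁, hc₁, hn₁, hT₁⟩ := exists_compactOperator_L2 hG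
  obtain ⟨T₂, hc₂, hn₂, hT₂⟩ := exists_compactOperator_L2 hG'
  set e := (WithLp.prodContinuousLinearEquiv 2 ℂ (Lp ℂ 2 (surfaceMeasure D))
    (Lp ℂ 2 (slobodeckijMeasure D))).symm
  set U := e.toContinuousLinearMap.comp (T₁.prod T₂) with hU
  have hUc : IsCompactOperator U := by
    have h : IsCompactOperator (T₁.prod T₂) := by
      have := (hc₁.clm_comp (ContinuousLinearMap.inl ℂ (Lp ℂ 2 (surfaceMeasure D))
        (Lp ℂ 2 (slobodeckijMeasure D)))).add (hc₂.clm_comp (ContinuousLinearMap.inr ℂ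
        (Lp ℂ 2 (surfaceMeasure D)) (Lp ℂ 2 (slobodeckijMeasure D))))
      refine (congrArg IsCompactOperator (funext fun ψ => ?_)).mpr this
      simp
    exact h.clm_comp e.toContinuousLinearMap
  have hmem : ∀ ψ, U ψ ∈ HHalfSubmodule D := fun ψ => ⟨fun x => ψ (G x), hT₁ ψ, by
    filter_upwards [hT₂ ψ] with p hp
    have : (U ψ).snd p = T₂ ψ p := rfl
    rw [this, hp, map_sub]⟩
  refine ⟨(U.codRestrict (HHalfSubmodule D) hmem : (H →L[ℂ] ℂ) →L[ℂ] HHalfSubmodule D),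
    IsCompactOperator.codRestrict hUc hmem (isClosed_HHalfSubmodule D), ?_, fun ψ => hT₁ ψ⟩
  refine ContinuousLinearMap.opNorm_le_bound _ (by positivity) fun ψ => ?_
  have h1 : ‖U ψ‖ ≤ ‖T₁ ψ‖ + ‖T₂ ψ‖ := by
    have h2 : ‖U ψ‖ ^ 2 = ‖T₁ ψ‖ ^ 2 + ‖T₂ ψ‖ ^ 2 := WithLp.prod_norm_sq_eq_of_L2 _
    refine abs_le_of_sq_le_sq' ?_ (by positivity) |>.2
    rw [h2]
    nlinarith [mul_nonneg (norm_nonneg (T₁ ψ)) (norm_nonneg (T₂ ψ))]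
  refine h1.trans ((add_le_add (T₁.le_opNorm ψ) (T₂.le_opNorm ψ)).trans ?_)
  rw [← add_mul]
  gcongr

end

/-! ### Energy estimates for weakly singular kernels -/

theorem weight_ne_zero (t : ℝ) : weight t ≠ 0 := by
  simp [weight]

theorem weight_zero : weight 0 = ⊤ := by simp [weight]

theorem weight_of_pos {t : ℝ} (ht : 0 < t) : weight t = ENNReal.ofReal ((√t ^ 3)⁻¹) := by
  rw [weight, ENNReal.ofReal_inv_of_pos (by positivity)]

/-- Comparison of the Slobodeckij weight `t⁻³` with a product of two weights. The degenerate values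
`t = 0` (where the left side is `∞ * 0`) and `a = 0` (where the right side is `∞`) are included. -/
theorem weight_sq_mul_le {q a t c : ℝ} (ha : 0 ≤ a) (ht : 0 ≤ t) (hc : 0 < c)
    (hq : t = 0 → q = 0) (h : q ^ 2 * √a ^ 3 ≤ c * √t ^ 3) :
    weight t ^ 2 * ENNReal.ofReal (q ^ 2) ≤ ENNReal.ofReal c * weight a * weight t := by
  rcases ht.eq_or_lt with rfl | ht
  · simp [hq rfl]
  rcases ha.eq_or_lt with rfl | ha
  · rw [weight_zero, ENNReal.mul_top (by simpa using hc), ENNReal.top_mul (weight_ne_zero t)]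
    exact le_top
  rw [weight_of_pos ht, weight_of_pos ha, ← ENNReal.ofReal_pow (by positivity),
    ← ENNReal.ofReal_mul (by positivity), ← ENNReal.ofReal_mul (by positivity),
    ← ENNReal.ofReal_mul (by positivity)]
  refine ENNReal.ofReal_le_ofReal ?_
  have h1 : 0 < √t ^ 3 := by positivity
  have h2 : 0 < √a ^ 3 := by positivity
  rw [inv_pow, inv_mul_eq_div, div_le_iff₀ (by positivity)]
  rw [show c * (√a ^ 3)⁻¹ * (√t ^ 3)⁻¹ * (√t ^ 3) ^ 2 = c * √t ^ 3 / √a ^ 3 by field_simp,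
    le_div_iff₀ h2]
  exact h

/-- Interpolation of `q ≤ B` and `q ≤ B t / a` to `q ^ 2 ≤ B ^ 2 (t / a) ^ (3/2)`. -/
theorem sq_mul_sqrt_pow_le {q a t B : ℝ} (hq : 0 ≤ q) (hB : 0 ≤ B)
    (h1 : q ≤ B) (h2 : q * a ≤ B * t) : q ^ 2 * √a ^ 3 ≤ B ^ 2 * √t ^ 3 := by
  have e1 : q ^ 2 * √a ^ 3 = √q * √(q * a) ^ 3 := by
    have := Real.sq_sqrt hq
    rw [Real.sqrt_mul hq]
    nth_rw 1 [← this]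
    ring
  have e2 : B ^ 2 * √t ^ 3 = √B * √(B * t) ^ 3 := by
    have := Real.sq_sqrt hB
    rw [Real.sqrt_mul hB]
    nth_rw 1 [← this]
    ring
  rw [e1, e2]
  gcongr

/-- Interpolation for double differences: from `q ≤ B min(h, t)` and `q ≤ B h t / a` one gets
`q ^ 2 ≤ B ^ 2 (h t) ^ (3/2) / a`, and `a⁻¹ ≤ R a ^ (-3/2)` as `a ≤ R` and `1 ≤ R`. -/
theorem sq_mul_sqrt_pow_le_of_double {q a t h B R : ℝ} (hq : 0 ≤ q) (ha : 0 ≤ a) (haR : a ≤ R)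
    (hR : 1 ≤ R) (ht : 0 ≤ t) (hh : 0 ≤ h) (hB : 0 ≤ B) (h1 : q ≤ B * h) (h2 : q ≤ B * t)
    (h3 : q * a ≤ B * (h * t)) : q ^ 2 * √a ^ 3 ≤ (B ^ 2 * R * √h ^ 3) * √t ^ 3 := by
  have hqq : q ≤ B * (√h * √t) := by
    rw [← Real.sqrt_mul hh, ← abs_of_nonneg hq, ← abs_of_nonneg hB,
      ← Real.sqrt_sq_eq_abs B, ← Real.sqrt_mul (by positivity)]
    refine Real.abs_le_sqrt ?_
    calc q ^ 2 = q * q := sq q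
      _ ≤ (B * h) * (B * t) := by gcongr
      _ = _ := by ring
  have hsa : √a ≤ R := by
    rw [Real.sqrt_le_left (by linarith)]
    nlinarith
  calc q ^ 2 * √a ^ 3 = (q * √a ^ 2) * q * √a := by ring
    _ = (q * a) * q * √a := by rw [Real.sq_sqrt ha]
    _ ≤ (B * (h * t)) * (B * (√h * √t)) * R := by gcongr
    _ = (B * (√h ^ 2 * √t ^ 2)) * (B * (√h * √t)) * R := by
      rw [Real.sq_sqrt hh, Real.sq_sqrt ht]
    _ = _ := by ring

theorem ae_mem_frontier (D : Set E3) : ∀ᵐ x ∂surfaceMeasure D, x ∈ frontier D :=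
  ae_restrict_mem isClosed_frontier.measurableSet

theorem enorm_sq_eq_ofReal (z : ℂ) : ‖z‖ₑ ^ 2 = ENNReal.ofReal (‖z‖ ^ 2) := by
  rw [ENNReal.ofReal_pow (norm_nonneg _), ofReal_norm]

/-- If the differences of `f` satisfy `|f y - f z| ^ 2 ≤ c (|y - z| / |x - y|) ^ (3/2)`, the double
integral is at most `c ∬ |x - y| ^ (-3/2) |y - z| ^ (-3/2)`, and both weights are integrable. -/
theorem slobodeckijEnergy_le {D : Set E3} [SFinite (surfaceMeasure D)] {A : ENNReal}
    (hA : ∀ x : E3, ∫⁻ y, weight ‖x - y‖ ∂surfaceMeasure D ≤ A) {f : E3 → ℂ} (hf : Measurable f)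
    {x : E3} {b c : ℝ} (hc : 0 < c) (h1 : ∀ y ∈ frontier D, ‖f y‖ ^ 2 ≤ b)
    (h2 : ∀ y ∈ frontier D, ∀ z ∈ frontier D,
      ‖f y - f z‖ ^ 2 * √‖x - y‖ ^ 3 ≤ c * √‖y - z‖ ^ 3) :
    slobodeckijEnergy D f ≤
      ENNReal.ofReal b * surfaceMeasure D Set.univ + ENNReal.ofReal c * (A * A) := by
  refine add_le_add ?_ ?_
  · rw [← lintegral_const]
    refine lintegral_mono_ae ?_
    filter_upwards [ae_mem_frontier D] with y hy
    rw [enorm_sq_eq_ofReal]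
    exact ENNReal.ofReal_le_ofReal (h1 y hy)
  · have hm : Measurable fun p : E3 × E3 => ‖f p.1 - f p.2‖ₑ ^ 2 := by fun_prop
    have hmw : ∀ y : E3, Measurable fun z : E3 => weight ‖y - z‖ := fun y =>
      measurable_weight.comp (by fun_prop)
    rw [lintegral_slobodeckijMeasure D hm]
    calc _ ≤ ∫⁻ y, ENNReal.ofReal c * (weight ‖x - y‖ * A) ∂surfaceMeasure D := by
          refine lintegral_mono_ae ?_
          filter_upwards [ae_mem_frontier D] with y hy
          calc _ ≤ ∫⁻ z, ENNReal.ofReal c * weight ‖x - y‖ * weight ‖y - z‖ ∂surfaceMeasure D := by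
                refine lintegral_mono_ae ?_
                filter_upwards [ae_mem_frontier D] with z hz
                rw [enorm_sq_eq_ofReal]
                refine weight_sq_mul_le (norm_nonneg _) (norm_nonneg _) hc (fun h => ?_)
                  (h2 y hy z hz)
                rw [norm_eq_zero, sub_eq_zero] at h
                simp [h]
            _ ≤ _ := by
                rw [lintegral_const_mul _ (hmw y), ← mul_assoc]
                gcongr
                exact hA y
      _ ≤ _ := by
          rw [lintegral_const_mul _ ((hmw x).mul_const _), lintegral_mul_const _ (hmw x)]
          gcongr
          exact hA x

/-- A kernel on the boundary that behaves like a function of `x - y` homogeneous of degree zero: it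
is bounded, and its differences in `y` are controlled by `|y - z| / |x - y|`, both with the same
constant `B`. The second condition is written without division, so it says nothing at `y = x`. -/
structure IsHomogeneousKernel (D : Set E3) (B : ℝ) (g : E3 → E3 → ℂ) : Prop where
  pos : 0 < B
  measurable : Measurable (Function.uncurry g)
  norm_le : ∀ x ∈ frontier D, ∀ y ∈ frontier D, ‖g x y‖ ≤ B
  norm_sub_le : ∀ x ∈ frontier D, ∀ y ∈ frontier D, ∀ z ∈ frontier D,
    ‖g x y - g x z‖ * ‖x - y‖ ≤ B * ‖y - z‖

/-- A kernel on the boundary that behaves like `|x - y|`: it is Lipschitz in each variable, and its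
double differences are controlled by `|x - x'| |y - z| / |x - y|`. -/
structure IsLipschitzKernel (D : Set E3) (B : ℝ) (g : E3 → E3 → ℂ) : Prop
    extends IsHomogeneousKernel D B g where
  norm_sub_left_le : ∀ x ∈ frontier D, ∀ x' ∈ frontier D, ∀ y ∈ frontier D,
    ‖g x y - g x' y‖ ≤ B * ‖x - x'‖
  norm_sub_right_le : ∀ x ∈ frontier D, ∀ y ∈ frontier D, ∀ z ∈ frontier D,
    ‖g x y - g x z‖ ≤ B * ‖y - z‖
  norm_double_le : ∀ x ∈ frontier D, ∀ x' ∈ frontier D, ∀ y ∈ frontier D, ∀ z ∈ frontier D,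
    ‖(g x y - g x' y) - (g x z - g x' z)‖ * ‖x - y‖ ≤ B * (‖x - x'‖ * ‖y - z‖)

theorem IsHomogeneousKernel.slobodeckijEnergy_le {D : Set E3} [SFinite (surfaceMeasure D)]
    {A : ENNReal} (hA : ∀ x : E3, ∫⁻ y, weight ‖x - y‖ ∂surfaceMeasure D ≤ A) {B : ℝ}
    {g : E3 → E3 → ℂ} (hg : IsHomogeneousKernel D B g) {x : E3} (hx : x ∈ frontier D) :
    slobodeckijEnergy D (g x) ≤
      ENNReal.ofReal (B ^ 2) * (surfaceMeasure D Set.univ + 4 * (A * A)) := by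
  have hB := hg.pos
  have hm : Measurable (g x) := hg.measurable.comp measurable_prodMk_left
  refine (_root_.slobodeckijEnergy_le hA (b := B ^ 2) (c := (2 * B) ^ 2) (x := x) hm (by positivity)
    (fun y hy => ?_) (fun y hy z hz => ?_)).trans (le_of_eq ?_)
  · have := hg.norm_le x hx y hy
    gcongr
  · refine sq_mul_sqrt_pow_le (norm_nonneg _) (by positivity) ?_ ?_
    · have := _root_.norm_sub_le (g x y) (g x z)
      linarith [hg.norm_le x hx y hy, hg.norm_le x hx z hz]
    · have := hg.norm_sub_le x hx y hy z hz
      nlinarith [mul_nonneg hB.le (norm_nonneg (y - z))]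
  · rw [mul_pow, mul_comm (2 ^ 2 : ℝ), ENNReal.ofReal_mul (by positivity)]
    norm_num
    ring

/-- The sections of a Lipschitz kernel are Hölder continuous of order `3/4` in `H^{1/2}(∂D)`. -/
theorem IsLipschitzKernel.slobodeckijEnergy_sub_le {D : Set E3} [SFinite (surfaceMeasure D)]
    {A : ENNReal} (hA : ∀ x : E3, ∫⁻ y, weight ‖x - y‖ ∂surfaceMeasure D ≤ A) {R : ℝ} (hR : 1 ≤ R)
    (hdiam : ∀ x ∈ frontier D, ∀ y ∈ frontier D, ‖x - y‖ ≤ R) {B : ℝ}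
    {g : E3 → E3 → ℂ} (hg : IsLipschitzKernel D B g) {x x' : E3} (hx : x ∈ frontier D)
    (hx' : x' ∈ frontier D) :
    slobodeckijEnergy D (fun y => g x y - g x' y) ≤ ENNReal.ofReal (√‖x - x'‖ ^ 3) *
      (ENNReal.ofReal (B ^ 2 * R) * (surfaceMeasure D Set.univ + 4 * (A * A))) := by
  have hB := hg.pos
  rcases eq_or_ne x x' with rfl | hne
  · simp [slobodeckijEnergy]
  have hh : 0 < ‖x - x'‖ := norm_pos_iff.2 (sub_ne_zero.2 hne)
  have hm : Measurable fun y => g x y - g x' y :=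
    (hg.measurable.comp measurable_prodMk_left).sub (hg.measurable.comp measurable_prodMk_left)
  refine (_root_.slobodeckijEnergy_le hA (b := B ^ 2 * R * √‖x - x'‖ ^ 3)
    (c := (2 * B) ^ 2 * R * √‖x - x'‖ ^ 3) (x := x) hm (by positivity) (fun y hy => ?_)
    (fun y hy z hz => ?_)).trans (le_of_eq ?_)
  · have h1 := hg.norm_sub_left_le x hx x' hx' y hy
    have hs : √‖x - x'‖ ≤ R := by
      rw [Real.sqrt_le_left (by linarith)]
      nlinarith [hdiam x hx x' hx']
    calc ‖g x y - g x' y‖ ^ 2 ≤ (B * ‖x - x'‖) ^ 2 := by gcongr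
      _ = (B * √‖x - x'‖ ^ 2) ^ 2 := by rw [Real.sq_sqrt hh.le]
      _ = B ^ 2 * √‖x - x'‖ * √‖x - x'‖ ^ 3 := by ring
      _ ≤ _ := by gcongr
  · refine sq_mul_sqrt_pow_le_of_double (norm_nonneg _) (norm_nonneg _) (hdiam x hx y hy) hR
      (norm_nonneg _) (norm_nonneg _) (by positivity) ?_ ?_ ?_
    · refine (norm_sub_le _ _).trans ?_
      linarith [hg.norm_sub_left_le x hx x' hx' y hy, hg.norm_sub_left_le x hx x' hx' z hz]
    · rw [sub_sub_sub_comm]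
      refine (norm_sub_le _ _).trans ?_
      linarith [hg.norm_sub_right_le x hx y hy z hz, hg.norm_sub_right_le x' hx' y hy z hz]
    · have := hg.norm_double_le x hx x' hx' y hy z hz
      nlinarith [mul_nonneg hB.le (mul_nonneg (norm_nonneg (x - x')) (norm_nonneg (y - z)))]
  · rw [show (2 * B) ^ 2 * R * √‖x - x'‖ ^ 3 = 4 * (B ^ 2 * R * √‖x - x'‖ ^ 3) by ring,
      ENNReal.ofReal_mul (p := 4) (by norm_num), ENNReal.ofReal_mul (q := √‖x - x'‖ ^ 3)
      (by positivity), show ENNReal.ofReal 4 = 4 by norm_num]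
    ring

/-! ### Operators with homogeneous and Lipschitz kernels -/

theorem norm_le_of_enorm_sq_le {E : Type*} [NormedAddCommGroup E] {v : E} {a : ℝ} {c : ENNReal}
    (ha : 0 ≤ a) (hc : c ≠ ⊤) (h : ‖v‖ₑ ^ 2 ≤ ENNReal.ofReal (a ^ 2) * c) :
    ‖v‖ ≤ a * √c.toReal := by
  rw [← ofReal_norm, ← ENNReal.ofReal_pow (norm_nonneg _), ← ENNReal.ofReal_toReal hc,
    ← ENNReal.ofReal_mul (by positivity), ENNReal.ofReal_le_ofReal_iff (by positivity)] at h
  refine abs_le_of_sq_le_sq' ?_ (by positivity) |>.2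
  rw [mul_pow, Real.sq_sqrt ENNReal.toReal_nonneg]
  exact h

/-- The sections `g x` of a homogeneous kernel are bounded in `H^{1/2}(∂D)`, and
`ψ ↦ (x ↦ ⟨ψ, g x⟩)` is a compact operator from `H^{-1/2}(∂D)` to `L²(∂D)`. -/
theorem IsBoundedLipschitzDomain.exists_operator_of_isHomogeneousKernel {D : Set E3}
    (hD : IsBoundedLipschitzDomain D) :
    ∃ Λ : ℝ, 0 ≤ Λ ∧ ∀ (B : ℝ) (g : E3 → E3 → ℂ), IsHomogeneousKernel D B g →
      ∃ (G : E3 → HHalf D) (T : HNegHalf D →L[ℂ] Lp ℂ 2 (surfaceMeasure D)),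
        (∀ x ∈ frontier D, HHalf.toL2 D (G x) =ᵐ[surfaceMeasure D] g x) ∧
        (∀ x ∈ frontier D, ‖G x‖ ≤ Λ * B) ∧ MemLp G 2 (surfaceMeasure D) ∧
        (eLpNorm G 2 (surfaceMeasure D)).toReal ≤ Λ * B ∧
        IsCompactOperator T ∧ ‖T‖ ≤ Λ * B ∧ ∀ ψ, T ψ =ᵐ[surfaceMeasure D] fun x => ψ (G x) := by
  have := hD.isFiniteMeasure_surfaceMeasure
  obtain ⟨A, hA⟩ := hD.exists_lintegral_weight_le
  set c : ENNReal := surfaceMeasure D Set.univ + 4 * (A * A) with hc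
  have hctop : c ≠ ⊤ := by finiteness
  set m : ENNReal := surfaceMeasure D Set.univ ^ (2 : ENNReal).toReal⁻¹ with hm
  have hmtop : m ≠ ⊤ := by
    refine ENNReal.rpow_ne_top_of_nonneg (by positivity) (measure_ne_top _ _)
  refine ⟨√c.toReal * (1 + m.toReal), by positivity, fun B g hg => ?_⟩
  have hB := hg.pos
  have hmem : ∀ x ∈ frontier D, MemHHalf D (g x) := fun x hx => by
    refine memHHalf_of_slobodeckijEnergy_ne_top (hg.measurable.comp measurable_prodMk_left)
      (ne_top_of_le_ne_top ?_ (hg.slobodeckijEnergy_le hA hx))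
    finiteness
  choose! G hG using hmem
  have hGn : ∀ x ∈ frontier D, ‖G x‖ ≤ B * √c.toReal := fun x hx => by
    refine norm_le_of_enorm_sq_le hB.le hctop ?_
    rw [HHalf.enorm_sq_eq _ (hG x hx)]
    exact hg.slobodeckijEnergy_le hA hx
  have hGae : ∀ᵐ x ∂surfaceMeasure D, ‖G x‖ ≤ B * √c.toReal := by
    filter_upwards [ae_mem_frontier D] with x hx using hGn x hx
  have hGm : MemLp G 2 (surfaceMeasure D) :=
    MemLp.of_bound (HHalf.aestronglyMeasurable_of_kernel hg.measurable hG) _ hGae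
  have hle : (eLpNorm G 2 (surfaceMeasure D)).toReal ≤ √c.toReal * (1 + m.toReal) * B := by
    have h1 := ENNReal.toReal_mono (by finiteness) (eLpNorm_le_of_ae_bound (p := 2) hGae)
    rw [ENNReal.toReal_mul, ENNReal.toReal_ofReal (by positivity)] at h1
    refine h1.trans ?_
    have : 0 ≤ B * √c.toReal := by positivity
    linarith
  obtain ⟨T, hTc, hTn, hT⟩ := exists_compactOperator_L2 hGm
  refine ⟨G, T, hG, fun x hx => (hGn x hx).trans ?_, hGm, hle, hTc, hTn.trans hle, hT⟩
  have : 0 ≤ √c.toReal * m.toReal * B := by positivity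
  linarith

/-- For a Lipschitz kernel, `ψ ↦ (x ↦ ⟨ψ, g x⟩)` is a compact operator from `H^{-1/2}(∂D)` to
`H^{1/2}(∂D)`. -/
theorem IsBoundedLipschitzDomain.exists_operator_of_isLipschitzKernel {D : Set E3}
    (hD : IsBoundedLipschitzDomain D) :
    ∃ Λ : ℝ, 0 ≤ Λ ∧ ∀ (B : ℝ) (g : E3 → E3 → ℂ), IsLipschitzKernel D B g →
      ∃ (G : E3 → HHalf D) (T : HNegHalf D →L[ℂ] HHalf D),
        (∀ x ∈ frontier D, HHalf.toL2 D (G x) =ᵐ[surfaceMeasure D] g x) ∧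
        (∀ x ∈ frontier D, ‖G x‖ ≤ Λ * B) ∧ IsCompactOperator T ∧ ‖T‖ ≤ Λ * B ∧
        ∀ ψ, HHalf.toL2 D (T ψ) =ᵐ[surfaceMeasure D] fun x => ψ (G x) := by
  have := hD.isFiniteMeasure_surfaceMeasure
  obtain ⟨A, hA⟩ := hD.exists_lintegral_weight_le
  obtain ⟨Λ, hΛ, hop⟩ := hD.exists_operator_of_isHomogeneousKernel
  obtain ⟨R, hR, hdiam⟩ := hD.exists_diameter_bound
  set c : ENNReal := surfaceMeasure D Set.univ + 4 * (A * A) with hc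
  have hctop : c ≠ ⊤ := by finiteness
  set c' : ENNReal := ENNReal.ofReal R * c * (A * surfaceMeasure D Set.univ) with hc'
  have hctop' : c' ≠ ⊤ := by finiteness
  refine ⟨Λ + √c'.toReal, by positivity, fun B g hg => ?_⟩
  have hB := hg.pos
  obtain ⟨G, -, hG, hGn, hGm, hGle, -⟩ := hop B g hg.toIsHomogeneousKernel
  have hdiff : ∀ x ∈ frontier D, ∀ x' ∈ frontier D, ‖G x - G x'‖ₑ ^ 2 ≤
      ENNReal.ofReal (B ^ 2 * R) * c * ENNReal.ofReal (√‖x - x'‖ ^ 3) := by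
    intro x hx x' hx'
    have e : HHalf.toL2 D (G x - G x') =ᵐ[surfaceMeasure D] fun y => g x y - g x' y := by
      rw [map_sub]
      exact (Lp.coeFn_sub _ _).trans ((hG x hx).sub (hG x' hx'))
    rw [HHalf.enorm_sq_eq _ e, mul_comm]
    exact hg.slobodeckijEnergy_sub_le hA hR hdiam hx hx'
  have hmeas : AEStronglyMeasurable (fun p : E3 × E3 => G p.1 - G p.2) (slobodeckijMeasure D) := by
    have h := hGm.aestronglyMeasurable
    exact ((h.comp_quasiMeasurePreserving Measure.quasiMeasurePreserving_fst).sub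
      (h.comp_quasiMeasurePreserving Measure.quasiMeasurePreserving_snd)).mono_ac
      (slobodeckijMeasure_absolutelyContinuous D)
  have hint : eLpNorm (fun p : E3 × E3 => G p.1 - G p.2) 2 (slobodeckijMeasure D) ^ 2 ≤
      ENNReal.ofReal (B ^ 2) * c' := by
    rw [eLpNorm_two_sq (slobodeckijMeasure D)]
    have hm : Measurable fun p : E3 × E3 =>
        ENNReal.ofReal (B ^ 2 * R) * c * ENNReal.ofReal (√‖p.1 - p.2‖ ^ 3) := by fun_prop
    calc _ ≤ ∫⁻ p : E3 × E3, ENNReal.ofReal (B ^ 2 * R) * c * ENNReal.ofReal (√‖p.1 - p.2‖ ^ 3)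
            ∂slobodeckijMeasure D := by
          refine lintegral_mono_ae ?_
          filter_upwards [ae_slobodeckijMeasure_of_ae (ae_mem_frontier D)] with p hp
          exact hdiff p.1 hp.1 p.2 hp.2
      _ ≤ ∫⁻ x, ∫⁻ y, ENNReal.ofReal (B ^ 2 * R) * c * weight ‖x - y‖ ∂surfaceMeasure D
            ∂surfaceMeasure D := by
          rw [lintegral_slobodeckijMeasure D hm]
          refine lintegral_mono fun x => lintegral_mono fun y => ?_
          change weight ‖x - y‖ ^ 2 * (_ * ENNReal.ofReal (√‖x - y‖ ^ 3)) ≤ _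
          rw [mul_left_comm, sq (weight _), mul_assoc (weight _)]
          gcongr
          calc weight ‖x - y‖ * (weight ‖x - y‖ * ENNReal.ofReal (√‖x - y‖ ^ 3))
              ≤ weight ‖x - y‖ * 1 := by
                gcongr
                exact ENNReal.inv_mul_le_one _
            _ = _ := mul_one _
      _ ≤ ∫⁻ _, ENNReal.ofReal (B ^ 2 * R) * c * A ∂surfaceMeasure D := by
          refine lintegral_mono fun x => ?_
          have hmw : Measurable fun y : E3 => weight ‖x - y‖ := measurable_weight.comp (by fun_prop)
          rw [lintegral_const_mul _ hmw]
          gcongr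
          exact hA x
      _ = ENNReal.ofReal (B ^ 2) * c' := by
          rw [lintegral_const, hc', ENNReal.ofReal_mul (by positivity)]
          ring
  have hGm' : MemLp (fun p : E3 × E3 => G p.1 - G p.2) 2 (slobodeckijMeasure D) := by
    refine ⟨hmeas, lt_top_iff_ne_top.2 fun ht => ?_⟩
    rw [ht, ENNReal.top_pow two_ne_zero] at hint
    exact absurd (top_le_iff.1 hint) (by finiteness)
  have hle' : (eLpNorm (fun p : E3 × E3 => G p.1 - G p.2) 2 (slobodeckijMeasure D)).toReal ≤
      B * √c'.toReal := by
    rw [← Lp.norm_toLp _ hGm']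
    refine norm_le_of_enorm_sq_le hB.le hctop' ?_
    rwa [Lp.enorm_toLp]
  obtain ⟨T, hTc, hTn, hT⟩ := exists_compactOperator_HHalf hGm hGm'
  refine ⟨G, T, hG, fun x hx => (hGn x hx).trans ?_, hTc, hTn.trans ?_, hT⟩
  · gcongr
    exact le_add_of_nonneg_right (Real.sqrt_nonneg _)
  · linarith

/-! ### Kernels built from powers of the distance -/

theorem abs_pow_sub_pow_le_of_le {R a b : ℝ} (hR : 1 ≤ R) (ha : |a| ≤ R) (hb : |b| ≤ R) (m : ℕ) :
    |a ^ m - b ^ m| ≤ m * R ^ m * |a - b| := by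
  refine (abs_pow_sub_pow_le a b m).trans ?_
  have h1 : max |a| |b| ^ (m - 1) ≤ R ^ m :=
    (pow_le_pow_left₀ (by positivity) (max_le ha hb) _).trans (pow_le_pow_right₀ hR (m.sub_le 1))
  calc |a - b| * m * max |a| |b| ^ (m - 1) ≤ |a - b| * m * R ^ m := by gcongr
    _ = _ := by ring

/-- Double differences of powers, from those of the base: `p, q, r, s` stand for the four distances
between two pairs of points at mutual distances `h` and `t`. -/
theorem abs_pow_double_le {R h t p q r s : ℝ} (hR : 1 ≤ R) (hp : |p| ≤ R) (hq : |q| ≤ R)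
    (hr : |r| ≤ R) (hs : |s| ≤ R) (h2 : |r - s| ≤ h) (h3 : |p - r| ≤ t)
    (h4 : |q - s| ≤ t) (m : ℕ) :
    |(p ^ m - q ^ m) - (r ^ m - s ^ m)| ≤
      m * R ^ m * |(p - q) - (r - s)| + m ^ 2 * R ^ m * (h * t) := by
  have hh : 0 ≤ h := (abs_nonneg _).trans h2
  have ht : 0 ≤ t := (abs_nonneg _).trans h3
  induction m with
  | zero => simp
  | succ m ih =>
    have e : (p ^ (m + 1) - q ^ (m + 1)) - (r ^ (m + 1) - s ^ (m + 1)) =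
        p * ((p ^ m - q ^ m) - (r ^ m - s ^ m)) + (p - r) * (r ^ m - s ^ m) +
          q ^ m * ((p - q) - (r - s)) + (r - s) * (q ^ m - s ^ m) := by ring
    set d := |(p - q) - (r - s)|
    have hd : 0 ≤ d := abs_nonneg _
    have hRm : R ^ m ≤ R ^ (m + 1) := pow_le_pow_right₀ hR m.le_succ
    have b1 : |p * ((p ^ m - q ^ m) - (r ^ m - s ^ m))| ≤
        R * (m * R ^ m * d + m ^ 2 * R ^ m * (h * t)) := by
      rw [abs_mul]; gcongr
    have b2 : |(p - r) * (r ^ m - s ^ m)| ≤ t * (m * R ^ (m + 1) * h) := by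
      rw [abs_mul]
      have := abs_pow_sub_pow_le_of_le hR hr hs m
      have : |r ^ m - s ^ m| ≤ m * R ^ (m + 1) * h := this.trans (by gcongr)
      gcongr
    have b3 : |q ^ m * ((p - q) - (r - s))| ≤ R ^ (m + 1) * d := by
      rw [abs_mul, abs_pow]
      gcongr
      exact (pow_le_pow_left₀ (abs_nonneg _) hq m).trans hRm
    have b4 : |(r - s) * (q ^ m - s ^ m)| ≤ h * (m * R ^ (m + 1) * t) := by
      rw [abs_mul]
      have := abs_pow_sub_pow_le_of_le hR hq hs m
      have : |q ^ m - s ^ m| ≤ m * R ^ (m + 1) * t := this.trans (by gcongr)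
      gcongr
    rw [e]
    refine ((abs_add_le _ _).trans (add_le_add ((abs_add_le _ _).trans (add_le_add
      ((abs_add_le _ _).trans (add_le_add b1 b2)) b3)) b4)).trans ?_
    have : 0 ≤ R ^ (m + 1) * (h * t) := by positivity
    push_cast
    rw [pow_succ R m] at *
    nlinarith

/-- The double difference of the distance function gains a factor `|x - y|`. With `p, q, r, s` the
four distances, `(p - q - r + s)(p + q + r + s)` is `p² - q² - r² + s² + 2 (p s - q r)`; the first
part is an inner product, and the second is bounded by Ptolemy's inequality. -/
theorem abs_norm_double_mul_le {V : Type*} [NormedAddCommGroup V] [InnerProductSpace ℝ V]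
    (x x' y z : V) :
    |(‖x - y‖ - ‖x' - y‖) - (‖x - z‖ - ‖x' - z‖)| * ‖x - y‖ ≤ 4 * (‖x - x'‖ * ‖y - z‖) := by
  have hpt1 := EuclideanGeometry.mul_dist_le_mul_dist_add_mul_dist x x' y z
  have hpt2 := EuclideanGeometry.mul_dist_le_mul_dist_add_mul_dist x x' z y
  simp only [dist_eq_norm] at hpt1 hpt2
  rw [norm_sub_rev z y] at hpt2
  have hin : ‖x - y‖ ^ 2 - ‖x' - y‖ ^ 2 - ‖x - z‖ ^ 2 + ‖x' - z‖ ^ 2 =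
      -2 * inner ℝ (x - x') (y - z) := by
    simp only [norm_sub_sq_real, inner_sub_left, inner_sub_right]
    ring
  have hcs := abs_real_inner_le_norm (x - x') (y - z)
  rw [abs_le] at hcs
  have hp := norm_nonneg (x - y)
  have hq := norm_nonneg (x' - y)
  have hr := norm_nonneg (x - z)
  have hs := norm_nonneg (x' - z)
  have hk : |(‖x - y‖ - ‖x' - y‖) - (‖x - z‖ - ‖x' - z‖)| *
      (‖x - y‖ + ‖x' - y‖ + ‖x - z‖ + ‖x' - z‖) ≤ 4 * (‖x - x'‖ * ‖y - z‖) := by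
    rw [← abs_of_nonneg (by positivity : 0 ≤ ‖x - y‖ + ‖x' - y‖ + ‖x - z‖ + ‖x' - z‖), ← abs_mul,
      abs_le]
    constructor <;> nlinarith
  refine le_trans ?_ hk
  gcongr
  linarith

/-- Positive powers of the distance are Lipschitz kernels, with a constant of exponential growth. -/
theorem isLipschitzKernel_norm_pow {D : Set E3} {R : ℝ} (hR : 1 ≤ R)
    (hdiam : ∀ x ∈ frontier D, ∀ y ∈ frontier D, ‖x - y‖ ≤ R) (m : ℕ) (hm : 1 ≤ m) :
    IsLipschitzKernel D (5 * m ^ 2 * R ^ (m + 1)) fun x y => ((‖x - y‖ ^ m : ℝ) : ℂ) := by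
  have hm' : (1 : ℝ) ≤ m := by exact_mod_cast hm
  have hmm : (m : ℝ) ≤ m ^ 2 := by nlinarith
  have hpow : R ^ m ≤ R ^ (m + 1) := pow_le_pow_right₀ hR m.le_succ
  have hpos : 0 < R ^ m := by positivity
  have habs : ∀ x ∈ frontier D, ∀ y ∈ frontier D, |‖x - y‖| ≤ R := fun x hx y hy => by
    rw [abs_norm]; exact hdiam x hx y hy
  have hright : ∀ x y z : E3, |‖x - y‖ - ‖x - z‖| ≤ ‖y - z‖ := fun x y z => by
    refine (abs_norm_sub_norm_le _ _).trans (le_of_eq ?_)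
    rw [sub_sub_sub_cancel_left, norm_sub_rev]
  have hleft : ∀ x x' y : E3, |‖x - y‖ - ‖x' - y‖| ≤ ‖x - x'‖ := fun x x' y => by
    refine (abs_norm_sub_norm_le _ _).trans (le_of_eq ?_)
    rw [sub_sub_sub_cancel_right]
  have hcoef : m * R ^ m ≤ m ^ 2 * R ^ (m + 1) := by gcongr
  have hcoef2 : m * R ^ m * R ≤ m ^ 2 * R ^ (m + 1) := by
    rw [mul_assoc, ← pow_succ]
    gcongr
  have hr1 : ∀ x ∈ frontier D, ∀ y ∈ frontier D, ∀ z ∈ frontier D,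
      |‖x - y‖ ^ m - ‖x - z‖ ^ m| ≤ m * R ^ m * ‖y - z‖ := fun x hx y hy z hz =>
    (abs_pow_sub_pow_le_of_le hR (habs x hx y hy) (habs x hx z hz) m).trans (by
      gcongr; exact hright x y z)
  refine ⟨⟨by positivity, ?_, fun x hx y hy => ?_, fun x hx y hy z hz => ?_⟩,
    fun x hx x' hx' y hy => ?_, fun x hx y hy z hz => ?_, fun x hx x' hx' y hy z hz => ?_⟩
  · unfold Function.uncurry
    fun_prop
  · rw [Complex.norm_real, Real.norm_eq_abs, abs_pow]
    refine (pow_le_pow_left₀ (abs_nonneg _) (habs x hx y hy) m).trans ?_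
    nlinarith
  · rw [← Complex.ofReal_sub, Complex.norm_real, Real.norm_eq_abs]
    calc _ ≤ m * R ^ m * ‖y - z‖ * R := by
          gcongr
          · exact hr1 x hx y hy z hz
          · exact hdiam x hx y hy
      _ = m * R ^ m * R * ‖y - z‖ := by ring
      _ ≤ _ := by
          have : 0 ≤ (m : ℝ) ^ 2 * R ^ (m + 1) := by positivity
          exact mul_le_mul_of_nonneg_right (by linarith) (norm_nonneg _)
  · rw [← Complex.ofReal_sub, Complex.norm_real, Real.norm_eq_abs]
    refine (abs_pow_sub_pow_le_of_le hR (habs x hx y hy) (habs x' hx' y hy) m).trans ?_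
    have := hleft x x' y
    gcongr
    nlinarith
  · rw [← Complex.ofReal_sub, Complex.norm_real, Real.norm_eq_abs]
    refine (hr1 x hx y hy z hz).trans ?_
    gcongr
    nlinarith
  · rw [← Complex.ofReal_sub, ← Complex.ofReal_sub, ← Complex.ofReal_sub, Complex.norm_real,
      Real.norm_eq_abs]
    have h1 := abs_pow_double_le hR (habs x hx y hy) (habs x' hx' y hy) (habs x hx z hz)
      (habs x' hx' z hz) (hleft x x' z) (hright x y z) (hright x' y z) m
    have h2 := abs_norm_double_mul_le x x' y z
    have hht : 0 ≤ ‖x - x'‖ * ‖y - z‖ := by positivity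
    calc _ ≤ (m * R ^ m * |(‖x - y‖ - ‖x' - y‖) - (‖x - z‖ - ‖x' - z‖)| +
            m ^ 2 * R ^ m * (‖x - x'‖ * ‖y - z‖)) * ‖x - y‖ := by gcongr
      _ = m * R ^ m * (|(‖x - y‖ - ‖x' - y‖) - (‖x - z‖ - ‖x' - z‖)| * ‖x - y‖) +
            m ^ 2 * R ^ m * (‖x - x'‖ * ‖y - z‖) * ‖x - y‖ := by ring
      _ ≤ m ^ 2 * R ^ (m + 1) * (4 * (‖x - x'‖ * ‖y - z‖)) +
            m ^ 2 * R ^ m * (‖x - x'‖ * ‖y - z‖) * R := by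
          gcongr
          exact hdiam x hx y hy
      _ = _ := by ring

/-- The kernel `|x - y| ^ j ⟪n x, x - y⟫ / |x - y|`, for a measurable field `n` of vectors of length
at most one. -/
theorem isHomogeneousKernel_inner {D : Set E3} {R : ℝ} (hR : 1 ≤ R)
    (hdiam : ∀ x ∈ frontier D, ∀ y ∈ frontier D, ‖x - y‖ ≤ R) {n : E3 → E3} (hn : Measurable n)
    (hn1 : ∀ x, ‖n x‖ ≤ 1) (j : ℕ) :
    IsHomogeneousKernel D ((j + 2) * R ^ (j + 1))
      fun x y => ((‖x - y‖ ^ j * (inner ℝ (n x) (x - y) / ‖x - y‖) : ℝ) : ℂ) := by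
  have hpow : R ^ j ≤ R ^ (j + 1) := pow_le_pow_right₀ hR j.le_succ
  have hpos : 0 < R ^ j := by positivity
  have hinner : ∀ x a : E3, |inner ℝ (n x) a| ≤ ‖a‖ := fun x a =>
    (abs_real_inner_le_norm _ _).trans (mul_le_of_le_one_left (norm_nonneg _) (hn1 x))
  have hu : ∀ x a : E3, |inner ℝ (n x) a / ‖a‖| ≤ 1 := fun x a => by
    rw [abs_div, abs_norm]
    exact div_le_one_of_le₀ (hinner x a) (norm_nonneg _)
  have hmul : ∀ x a : E3, ‖a‖ * (inner ℝ (n x) a / ‖a‖) = inner ℝ (n x) a := fun x a => by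
    rcases eq_or_ne a 0 with rfl | ha
    · simp
    · field_simp
  refine ⟨by positivity, ?_, fun x hx y hy => ?_, fun x hx y hy z hz => ?_⟩
  · unfold Function.uncurry
    fun_prop
  · rw [Complex.norm_real, Real.norm_eq_abs, abs_mul, abs_pow, abs_norm]
    calc ‖x - y‖ ^ j * |inner ℝ (n x) (x - y) / ‖x - y‖| ≤ R ^ j * 1 := by
          gcongr
          · exact hdiam x hx y hy
          · exact hu x _
      _ ≤ _ := by
          have : (0 : ℝ) ≤ j := by positivity
          nlinarith
  · rw [← Complex.ofReal_sub, Complex.norm_real, Real.norm_eq_abs]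
    set a := x - y with ha
    set b := x - z with hb
    have hab : ‖a - b‖ = ‖y - z‖ := by
      rw [ha, hb, sub_sub_sub_cancel_left, norm_sub_rev]
    set u := inner ℝ (n x) a / ‖a‖
    set v := inner ℝ (n x) b / ‖b‖
    have haR : ‖a‖ ≤ R := hdiam x hx y hy
    have hbR : ‖b‖ ≤ R := hdiam x hx z hz
    have hd : |‖a‖ - ‖b‖| ≤ ‖a - b‖ := abs_norm_sub_norm_le a b
    have hv : |v| ≤ 1 := hu x b
    have h1 : |‖a‖ * (u - v)| ≤ 2 * ‖a - b‖ := by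
      have e : ‖a‖ * (u - v) = inner ℝ (n x) (a - b) - (‖a‖ - ‖b‖) * v := by
        rw [inner_sub_right, ← hmul x a, ← hmul x b]
        ring
      rw [e]
      refine (abs_sub _ _).trans ?_
      rw [abs_mul]
      have := hinner x (a - b)
      nlinarith [abs_nonneg v, abs_nonneg (‖a‖ - ‖b‖)]
    have h2 : |‖a‖ ^ j - ‖b‖ ^ j| ≤ j * R ^ j * ‖a - b‖ :=
      (abs_pow_sub_pow_le_of_le hR (by rwa [abs_norm]) (by rwa [abs_norm]) j).trans (by gcongr)
    have e : |‖a‖ ^ j * u - ‖b‖ ^ j * v| * ‖a‖ =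
        |‖a‖ ^ j * (‖a‖ * (u - v)) + (‖a‖ ^ j - ‖b‖ ^ j) * v * ‖a‖| := by
      rw [← abs_of_nonneg (norm_nonneg a), ← abs_mul, abs_norm]
      ring_nf
    rw [e, ← hab]
    calc _ ≤ |‖a‖ ^ j * (‖a‖ * (u - v))| + |(‖a‖ ^ j - ‖b‖ ^ j) * v * ‖a‖| := abs_add_le _ _
      _ = ‖a‖ ^ j * |‖a‖ * (u - v)| + |‖a‖ ^ j - ‖b‖ ^ j| * |v| * ‖a‖ := by
          rw [abs_mul, abs_mul (_ * v), abs_mul (_ - _) v, abs_pow, abs_norm]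
      _ ≤ R ^ (j + 1) * (2 * ‖a - b‖) + (j * R ^ j * ‖a - b‖) * 1 * R := by
          have : ‖a‖ ^ j ≤ R ^ (j + 1) := (pow_le_pow_left₀ (norm_nonneg a) haR j).trans hpow
          gcongr
      _ = _ := by ring

/-! ### Measurability of the normal -/

theorem outwardNormal_spec {D : Set E3} {x n : E3} (h : IsOutwardUnitNormal D x n) :
    outwardNormal D x = n := by
  have hex : ∃ n, IsOutwardUnitNormal D x n := ⟨n, h⟩
  rw [outwardNormal, dif_pos hex]
  exact hex.choose_spec.unique h

theorem norm_outwardNormal_le (D : Set E3) (x : E3) : ‖outwardNormal D x‖ ≤ 1 := by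
  by_cases h : ∃ n, IsOutwardUnitNormal D x n
  · obtain ⟨n, hn⟩ := h
    rw [outwardNormal_spec hn, hn.1]
  · rw [outwardNormal, dif_neg h, norm_zero]
    exact zero_le_one

/-- The condition for `n` to be the outward unit normal at `x`, with fixed precision `ε` and
radius `δ`, is closed in `(x, n)`. -/
theorem isClosed_setOf_normal_condition (D : Set E3) (ε δ : ℝ) :
    IsClosed {p : E3 × E3 | ∀ y, ‖y - p.1‖ < δ →
      (inner ℝ (y - p.1) p.2 < -ε * ‖y - p.1‖ → y ∈ D) ∧
      (ε * ‖y - p.1‖ < inner ℝ (y - p.1) p.2 → y ∉ D)} := by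
  simp only [Set.ofPred_forall]
  refine isClosed_iInter fun y => ?_
  have h1 : IsOpen {p : E3 × E3 | ‖y - p.1‖ < δ} := isOpen_lt (by fun_prop) continuous_const
  have h2 : IsOpen {p : E3 × E3 | inner ℝ (y - p.1) p.2 < -ε * ‖y - p.1‖} :=
    isOpen_lt (by fun_prop) (by fun_prop)
  have h3 : IsOpen {p : E3 × E3 | ε * ‖y - p.1‖ < inner ℝ (y - p.1) p.2} :=
    isOpen_lt (by fun_prop) (by fun_prop)
  exact isClosed_imp h1 ((isClosed_imp h2 isClosed_const).and (isClosed_imp h3 isClosed_const))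

/-- The defining condition with precision and radius running through countably many values. -/
theorem isOutwardUnitNormal_iff_nat {D : Set E3} {x n : E3} :
    IsOutwardUnitNormal D x n ↔ ‖n‖ = 1 ∧ ∀ i : ℕ, ∃ j : ℕ, ∀ y, ‖y - x‖ < 1 / ((j : ℝ) + 1) →
      (inner ℝ (y - x) n < -(1 / ((i : ℝ) + 1)) * ‖y - x‖ → y ∈ D) ∧
      (1 / ((i : ℝ) + 1) * ‖y - x‖ < inner ℝ (y - x) n → y ∉ D) := by
  refine and_congr_right fun _ => ⟨fun h i => ?_, fun h ε hε => ?_⟩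
  · obtain ⟨δ, hδ, hball⟩ := Metric.eventually_nhds_iff.1 (h (1 / ((i : ℝ) + 1)) (by positivity))
    obtain ⟨j, hj⟩ := exists_nat_one_div_lt hδ
    exact ⟨j, fun y hy => hball (by rw [dist_eq_norm]; exact hy.trans hj)⟩
  · obtain ⟨i, hi⟩ := exists_nat_one_div_lt hε
    obtain ⟨j, hj⟩ := h i
    refine Metric.eventually_nhds_iff.2 ⟨1 / ((j : ℝ) + 1), by positivity, fun y hy => ?_⟩
    rw [dist_eq_norm] at hy
    have hle : 1 / ((i : ℝ) + 1) * ‖y - x‖ ≤ ε * ‖y - x‖ := by gcongr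
    exact ⟨fun h1 => (hj y hy).1 (h1.trans_le (by linarith)),
      fun h1 => (hj y hy).2 (hle.trans_lt h1)⟩

theorem measurableSet_setOf_isOutwardUnitNormal (D : Set E3) :
    MeasurableSet {p : E3 × E3 | IsOutwardUnitNormal D p.1 p.2} := by
  simp only [isOutwardUnitNormal_iff_nat, Set.ofPred_and, Set.ofPred_forall, Set.ofPred_exists]
  refine MeasurableSet.inter (isClosed_eq (by fun_prop) continuous_const).measurableSet ?_
  refine MeasurableSet.iInter fun i => MeasurableSet.iUnion fun j => ?_
  have := (isClosed_setOf_normal_condition D (1 / ((i : ℝ) + 1)) (1 / ((j : ℝ) + 1))).measurableSet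
  simpa only [Set.ofPred_forall] using this

/-- The outward normal is Borel measurable: its graph is a Borel set on which the projection to
the base point is injective, so the Lusin–Souslin theorem applies. -/
theorem measurable_outwardNormal (D : Set E3) : Measurable (outwardNormal D) := by
  have hinj : ∀ s : Set (E3 × E3), s ⊆ {p | IsOutwardUnitNormal D p.1 p.2} →
      Set.InjOn Prod.fst s := by
    rintro s hs ⟨x, n⟩ h1 ⟨x', n'⟩ h2 (rfl : x = x')
    exact Prod.ext rfl ((hs h1).unique (hs h2))
  have hN := measurableSet_setOf_isOutwardUnitNormal D
  have hdom : MeasurableSet (Prod.fst '' {p : E3 × E3 | IsOutwardUnitNormal D p.1 p.2}) :=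
    hN.image_of_measurable_injOn measurable_fst (hinj _ subset_rfl)
  intro U hU
  have himg : MeasurableSet
      (Prod.fst '' ({p : E3 × E3 | IsOutwardUnitNormal D p.1 p.2} ∩ Prod.snd ⁻¹' U)) :=
    (hN.inter (measurable_snd hU)).image_of_measurable_injOn measurable_fst
      (hinj _ Set.inter_subset_left)
  have hzero : MeasurableSet {_x : E3 | (0 : E3) ∈ U} := MeasurableSet.const _
  have e : outwardNormal D ⁻¹' U =
      (Prod.fst '' ({p : E3 × E3 | IsOutwardUnitNormal D p.1 p.2} ∩ Prod.snd ⁻¹' U)) ∪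
      ((Prod.fst '' {p : E3 × E3 | IsOutwardUnitNormal D p.1 p.2})ᶜ ∩
        {_x : E3 | (0 : E3) ∈ U}) := by
    ext x
    by_cases h : ∃ n, IsOutwardUnitNormal D x n
    · obtain ⟨n, hn⟩ := h
      have h1 : ∀ m, IsOutwardUnitNormal D x m ↔ m = n :=
        fun m => ⟨fun hm => hm.unique hn, fun hm => hm ▸ hn⟩
      simp [outwardNormal_spec hn, h1]
    · have h0 : outwardNormal D x = 0 := by rw [outwardNormal, dif_neg h]
      have h1 : ∀ m, ¬ IsOutwardUnitNormal D x m := fun m hm => h ⟨m, hm⟩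
      simp [h0, h1]
  rw [e]
  exact himg.union (hdom.compl.inter hzero)

/-! ### Power series in the wave number -/

/-- The Taylor coefficients of `k ↦ Γ₁^k(x)`: the coefficient of `k ^ n` is this number times
`|x| ^ (n + 1)`. -/
noncomputable def gamCoeff (n : ℕ) : ℂ := Complex.I ^ n / (4 * Real.pi * (n + 2).factorial)

theorem gamCoeff_ne_zero (n : ℕ) : gamCoeff n ≠ 0 := by
  have : (Real.pi : ℂ) ≠ 0 := by exact_mod_cast Real.pi_ne_zero
  have := Nat.factorial_ne_zero (n + 2)
  unfold gamCoeff
  simp [*]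

theorem norm_gamCoeff_le (n : ℕ) : ‖gamCoeff n‖ ≤ 1 / (n + 2).factorial := by
  rw [gamCoeff, norm_div, norm_pow, Complex.norm_I, one_pow, norm_mul, norm_mul]
  simp only [Complex.norm_natCast, Complex.norm_real, Real.norm_eq_abs, abs_of_pos Real.pi_pos,
    Complex.norm_ofNat]
  gcongr
  have := Real.pi_gt_three
  have h : (0 : ℝ) ≤ (n + 2).factorial := by positivity
  nlinarith

theorem HasSum.of_eq {f g : ℕ → ℂ} {a b : ℂ} (h : HasSum f a) (hf : ∀ n, g n = f n) (hab : b = a) :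
    HasSum g b := by
  rw [hab, funext hf]
  exact h

theorem hasSum_exp_shift (w : ℂ) :
    HasSum (fun n : ℕ => w ^ (n + 2) / (n + 2).factorial) (Complex.exp w - 1 - w) := by
  have h := NormedSpace.expSeries_div_hasSum_exp (𝔸 := ℂ) w
  rw [← Complex.exp_eq_exp_ℂ] at h
  have := (hasSum_nat_add_iff' 2).2 h
  simpa [Finset.sum_range_succ, sub_sub] using this

theorem hasSum_exp_sub_one (w : ℂ) :
    HasSum (fun n : ℕ => w ^ (n + 1) / (n + 1).factorial) (Complex.exp w - 1) := by
  have h := NormedSpace.expSeries_div_hasSum_exp (𝔸 := ℂ) w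
  rw [← Complex.exp_eq_exp_ℂ] at h
  have := (hasSum_nat_add_iff' 1).2 h
  simpa [Finset.sum_range_succ, sub_sub] using this

theorem hasSum_Gam1 (k : ℂ) (x : E3) :
    HasSum (fun n : ℕ => k ^ n * (gamCoeff n * (‖x‖ ^ (n + 1) : ℝ))) (Gam1 k x) := by
  have hpi : (Real.pi : ℂ) ≠ 0 := by exact_mod_cast Real.pi_ne_zero
  rcases eq_or_ne x 0 with rfl | hx
  · simp [Gam1, hasSum_zero]
  rcases eq_or_ne k 0 with rfl | hk
  · have : Gam1 0 x = (0 : ℂ) ^ 0 * (gamCoeff 0 * (‖x‖ ^ (0 + 1) : ℝ)) := by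
      simp [Gam1, hx, gamCoeff]
      field_simp
      ring
    rw [this]
    exact hasSum_single 0 fun n hn => by simp [hn]
  have hr : (‖x‖ : ℂ) ≠ 0 := by exact_mod_cast (norm_pos_iff.2 hx).ne'
  have h := (hasSum_exp_shift (Complex.I * k * ‖x‖)).mul_left
    (-(1 / (4 * (Real.pi : ℂ) * (‖x‖ : ℂ) * k ^ 2)))
  have e : Gam1 k x = -(1 / (4 * (Real.pi : ℂ) * (‖x‖ : ℂ) * k ^ 2)) *
      (Complex.exp (Complex.I * k * ‖x‖) - 1 - Complex.I * k * ‖x‖) := by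
    simp only [Gam1, if_neg hx, if_neg hk, Gam, mul_zero, zero_mul, Complex.exp_zero]
    field_simp
    ring
  refine h.of_eq (fun n => ?_) e
  rw [gamCoeff, mul_pow, mul_pow, pow_add Complex.I, Complex.I_sq]
  push_cast
  have := Nat.cast_ne_zero (R := ℂ).2 (Nat.factorial_ne_zero (n + 2))
  field_simp
  ring

theorem hasFDerivAt_norm {z : E3} (hz : z ≠ 0) :
    HasFDerivAt (fun z : E3 => ‖z‖) (‖z‖⁻¹ • innerSL ℝ z) z := by
  have hz' : 0 < ‖z‖ := norm_pos_iff.2 hz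
  have h := (hasStrictFDerivAt_norm_sq z).hasFDerivAt.sqrt (by positivity)
  simp only [Real.sqrt_sq (norm_nonneg _)] at h
  refine h.congr_fderiv ?_
  rw [← Nat.cast_smul_eq_nsmul ℝ, smul_smul]
  congr 1
  push_cast
  field_simp

/-- The normal derivative of a radial function. -/
theorem fderiv_radial {f : E3 → ℂ} {φ : ℝ → ℂ} {φ' : ℂ} {z : E3} (hz : z ≠ 0)
    (hf : ∀ y ≠ 0, f y = φ ‖y‖) (hφ : HasDerivAt φ φ' ‖z‖) (v : E3) :
    fderiv ℝ f z v = φ' * (inner ℝ v z / ‖z‖ : ℝ) := by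
  have h1 := hφ.hasFDerivAt.comp z (hasFDerivAt_norm hz)
  have h2 : f =ᶠ[𝓝 z] φ ∘ fun z : E3 => ‖z‖ := by
    filter_upwards [isOpen_ne.mem_nhds hz] with y hy using hf y hy
  rw [(h1.congr_of_eventuallyEq h2).fderiv]
  simp [real_inner_comm v z]
  ring

/-- The Taylor series in `k` of a directional derivative of `Γ₁^k` is the termwise derivative of
that of `Γ₁^k`. -/
theorem hasSum_fderiv_Gam1 (k : ℂ) {z : E3} (hz : z ≠ 0) (v : E3) :
    HasSum (fun n : ℕ => k ^ n * ((gamCoeff n * (n + 1)) *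
      (‖z‖ ^ n * (inner ℝ v z / ‖z‖) : ℝ))) (fderiv ℝ (Gam1 k) z v) := by
  have hpi : (Real.pi : ℂ) ≠ 0 := by exact_mod_cast Real.pi_ne_zero
  have hr : (‖z‖ : ℂ) ≠ 0 := by exact_mod_cast (norm_pos_iff.2 hz).ne'
  rcases eq_or_ne k 0 with rfl | hk
  · have hd : HasDerivAt (fun t : ℝ => (t : ℂ) / (8 * (Real.pi : ℂ))) (1 / (8 * (Real.pi : ℂ)))
        ‖z‖ := (Complex.ofRealCLM.hasDerivAt (x := ‖z‖)).div_const _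
    rw [fderiv_radial hz (fun y hy => by simp [Gam1, hy]) hd]
    have : 1 / (8 * (Real.pi : ℂ)) * (inner ℝ v z / ‖z‖ : ℝ) = (0 : ℂ) ^ 0 *
        ((gamCoeff 0 * ((0 : ℕ) + 1)) * (‖z‖ ^ 0 * (inner ℝ v z / ‖z‖) : ℝ)) := by
      simp [gamCoeff]
      left
      ring
    rw [this]
    exact hasSum_single 0 fun n hn => by simp [hn]
  set w : ℂ := Complex.I * k * ‖z‖ with hw
  have hlin : HasDerivAt (fun t : ℝ => Complex.I * k * (t : ℂ)) (Complex.I * k) ‖z‖ := by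
    simpa using (Complex.ofRealCLM.hasDerivAt (x := ‖z‖)).const_mul (Complex.I * k)
  have hden : HasDerivAt (fun t : ℝ => 4 * (Real.pi : ℂ) * k ^ 2 * (t : ℂ))
      (4 * (Real.pi : ℂ) * k ^ 2) ‖z‖ := by
    simpa using (Complex.ofRealCLM.hasDerivAt (x := ‖z‖)).const_mul (4 * (Real.pi : ℂ) * k ^ 2)
  have hd : HasDerivAt (fun t : ℝ => -(Complex.exp (Complex.I * k * t) - 1 - Complex.I * k * t) /
      (4 * (Real.pi : ℂ) * k ^ 2 * t)) (-(1 / (4 * (Real.pi : ℂ) * k ^ 2 * (‖z‖ : ℂ) ^ 2)) *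
        (w * (Complex.exp w - 1) - (Complex.exp w - 1 - w))) ‖z‖ := by
    refine ((((hlin.cexp.sub_const 1).fun_sub hlin).fun_neg).fun_div hden ?_).congr_deriv ?_
    · simp only [ne_eq, mul_eq_zero, not_or]
      exact ⟨⟨⟨by norm_num, hpi⟩, pow_ne_zero 2 hk⟩, hr⟩
    · rw [← hw]
      field_simp
      rw [hw]
      ring
  rw [fderiv_radial hz (fun y hy => ?_) hd]
  · refine ((((hasSum_exp_sub_one w).mul_left w).sub (hasSum_exp_shift w)).mul_left
      (-(1 / (4 * (Real.pi : ℂ) * k ^ 2 * (‖z‖ : ℂ) ^ 2)) * (inner ℝ v z / ‖z‖ : ℝ))).of_eq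
      (fun n => ?_) (by ring)
    have h1 := Nat.cast_ne_zero (R := ℂ).2 (Nat.factorial_ne_zero (n + 1))
    have h2 : ((n : ℂ) + 1 + 1) ≠ 0 := by exact_mod_cast (by omega : n + 1 + 1 ≠ 0)
    have e : w * (w ^ (n + 1) / ((n + 1).factorial : ℂ)) - w ^ (n + 2) / ((n + 2).factorial : ℂ) =
        -(Complex.I ^ n * k ^ (n + 2) * (‖z‖ : ℂ) ^ (n + 2)) * (n + 1) /
          ((n + 2).factorial : ℂ) := by
      have e1 : w ^ (n + 2) = -(Complex.I ^ n * k ^ (n + 2) * (‖z‖ : ℂ) ^ (n + 2)) := by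
        rw [hw, mul_pow, mul_pow, pow_add Complex.I n 2, Complex.I_sq]
        ring
      rw [← e1, Nat.factorial_succ (n + 1)]
      push_cast
      field_simp
      ring
    rw [e, gamCoeff]
    have h3 := Nat.cast_ne_zero (R := ℂ).2 (Nat.factorial_ne_zero (n + 2))
    push_cast
    field_simp
    ring
  · simp only [Gam1, if_neg hy, if_neg hk, Gam, mul_zero, zero_mul, Complex.exp_zero]
    have hy' : (‖y‖ : ℂ) ≠ 0 := by exact_mod_cast (norm_pos_iff.2 hy).ne'
    simp
    field_simp
    ring

/-! ### Summation of the operators -/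

theorem summable_majorant (M ρ : ℝ) (r : ℝ) :
    Summable fun n : ℕ => r ^ n * (M * (ρ ^ n / n.factorial)) := by
  have := (Real.summable_pow_div_factorial (r * ρ)).mul_left M
  refine this.congr fun n => ?_
  rw [mul_pow]
  ring

theorem norm_pow_smul_le {E : Type*} [NormedAddCommGroup E] [NormedSpace ℂ E] {v : ℕ → E}
    {M ρ : ℝ} (hv : ∀ n, ‖v n‖ ≤ M * (ρ ^ n / n.factorial)) {k : ℂ} {r : ℝ} (hk : ‖k‖ ≤ r) (n : ℕ) :
    ‖k ^ n • v n‖ ≤ r ^ n * (M * (ρ ^ n / n.factorial)) := by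
  rw [norm_smul, norm_pow]
  have := hv n
  have hr : 0 ≤ r := (norm_nonneg k).trans hk
  gcongr

theorem summable_norm_pow_smul {E : Type*} [NormedAddCommGroup E] [NormedSpace ℂ E] {v : ℕ → E}
    {M ρ : ℝ} (hv : ∀ n, ‖v n‖ ≤ M * (ρ ^ n / n.factorial)) (k : ℂ) :
    Summable fun n => ‖k ^ n • v n‖ :=
  Summable.of_nonneg_of_le (fun _ => norm_nonneg _) (norm_pow_smul_le hv le_rfl)
    (summable_majorant M ρ ‖k‖)

theorem analyticOnNhd_tsum_pow_smul {E : Type*} [NormedAddCommGroup E] [NormedSpace ℂ E]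
    [CompleteSpace E] {v : ℕ → E} {M ρ : ℝ} (hv : ∀ n, ‖v n‖ ≤ M * (ρ ^ n / n.factorial)) :
    AnalyticOnNhd ℂ (fun k : ℂ => ∑' n, k ^ n • v n) Set.univ := by
  intro k _
  have hd : DifferentiableOn ℂ (fun k : ℂ => ∑' n, k ^ n • v n) (Metric.ball 0 (‖k‖ + 1)) := by
    refine Complex.differentiableOn_tsum_of_summable_norm (summable_majorant M ρ (‖k‖ + 1))
      (fun n => ?_) Metric.isOpen_ball fun n w hw => ?_
    · exact ((differentiable_id.pow n).smul_const (v n)).differentiableOn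
    · exact norm_pow_smul_le hv (mem_ball_zero_iff.1 hw).le n
  exact hd.analyticAt (Metric.isOpen_ball.mem_nhds (by simp))

theorem isCompactOperator_tsum_pow_smul {F E : Type*} [NormedAddCommGroup F] [NormedSpace ℂ F]
    [NormedAddCommGroup E] [NormedSpace ℂ E] [CompleteSpace E] {T : ℕ → F →L[ℂ] E} {M ρ : ℝ}
    (hT : ∀ n, ‖T n‖ ≤ M * (ρ ^ n / n.factorial)) (hc : ∀ n, IsCompactOperator (T n)) (k : ℂ) :
    IsCompactOperator (∑' n, k ^ n • T n : F →L[ℂ] E) := by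
  have hs := (summable_norm_pow_smul hT k).of_norm.hasSum
  refine isClosed_setOfPred_isCompactOperator.mem_of_tendsto hs (Filter.Eventually.of_forall ?_)
  intro s
  change IsCompactOperator (∑ n ∈ s, k ^ n • T n : F →L[ℂ] E)
  induction s using Finset.cons_induction with
  | empty => exact isCompactOperator_zero
  | cons n s hn ih =>
    rw [Finset.sum_cons]
    exact ((hc n).smul (k ^ n)).add ih

theorem surfaceMeasure_singleton (D : Set E3) (x : E3) : surfaceMeasure D {x} = 0 := by
  refine le_antisymm ((Measure.restrict_le_self _).trans (le_of_eq ?_)) zero_le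
  have : NullSingletonClass (μH[(2 : ℕ)] : Measure E3) :=
    Measure.nullSingletonClass_hausdorff E3 (by norm_num)
  rw [Measure.euclideanHausdorffMeasure_def, Measure.smul_apply, measure_singleton, smul_zero]

section
variable {D : Set E3} [SFinite (surfaceMeasure D)] {κ : ℂ → E3 → E3 → ℂ} {g : ℕ → E3 → E3 → ℂ}
  {G : ℕ → E3 → HHalf D} {M ρ : ℝ}

/-- If the kernels `g n x` are represented by `G n x ∈ H^{1/2}(∂D)` with norms of factorial decay,
then the pointwise sum of the power series of kernels belongs to `H^{1/2}(∂D)`, and pairings with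
it can be computed term by term. -/
theorem exists_HHalf_hasSum
    (hκ : ∀ k, ∀ x ∈ frontier D, ∀ᵐ y ∂surfaceMeasure D,
      HasSum (fun n => k ^ n * g n x y) (κ k x y))
    (hG : ∀ n, ∀ x ∈ frontier D, HHalf.toL2 D (G n x) =ᵐ[surfaceMeasure D] g n x)
    (hn : ∀ n, ∀ x ∈ frontier D, ‖G n x‖ ≤ M * (ρ ^ n / n.factorial))
    (k : ℂ) {x : E3} (hx : x ∈ frontier D) :
    ∃ u : HHalf D, HHalf.toL2 D u =ᵐ[surfaceMeasure D] κ k x ∧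
      ∀ ψ : HNegHalf D, HasSum (fun n => k ^ n * ψ (G n x)) (ψ u) := by
  have hsn := summable_norm_pow_smul (v := fun n => G n x) (fun n => hn n x hx) k
  have hs := hsn.of_norm.hasSum
  refine ⟨∑' n, k ^ n • G n x, ?_, fun ψ => by simpa using ψ.hasSum hs⟩
  have hL := (HHalf.toL2 D).hasSum hs
  have hLn : Summable fun n => ‖HHalf.toL2 D (k ^ n • G n x)‖ :=
    Summable.of_nonneg_of_le (fun _ => norm_nonneg _) (fun n => (HHalf.toL2 D).le_opNorm _)
      (hsn.mul_left _)
  have hae := Lp.hasSum_coeFn_tsum (tsum_enorm_ne_top_iff_summable_norm.2 hLn)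
  rw [hL.tsum_eq] at hae
  have hterm : ∀ᵐ y ∂surfaceMeasure D, ∀ n, HHalf.toL2 D (k ^ n • G n x) y = k ^ n * g n x y := by
    refine ae_all_iff.2 fun n => ?_
    rw [map_smul]
    filter_upwards [Lp.coeFn_smul (k ^ n) (HHalf.toL2 D (G n x)), hG n x hx] with y h1 h2
    rw [h1, Pi.smul_apply, h2, smul_eq_mul]
  filter_upwards [hae, hterm, hκ k x hx] with y h1 h2 h3
  simp only [h2] at h1
  exact h1.unique h3

/-- The sum of the operators with kernels `g n` is the operator of duality pairings with the summed
kernel. -/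
theorem tsum_ae_eq_pairing
    (hκ : ∀ k, ∀ x ∈ frontier D, ∀ᵐ y ∂surfaceMeasure D,
      HasSum (fun n => k ^ n * g n x y) (κ k x y))
    (hG : ∀ n, ∀ x ∈ frontier D, HHalf.toL2 D (G n x) =ᵐ[surfaceMeasure D] g n x)
    (hn : ∀ n, ∀ x ∈ frontier D, ‖G n x‖ ≤ M * (ρ ^ n / n.factorial))
    {T : ℕ → HNegHalf D →L[ℂ] Lp ℂ 2 (surfaceMeasure D)} {M' : ℝ}
    (hTn : ∀ n, ‖T n‖ ≤ M' * (ρ ^ n / n.factorial))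
    (hT : ∀ n ψ, T n ψ =ᵐ[surfaceMeasure D] fun x => ψ (G n x)) (k : ℂ) (ψ : HNegHalf D) :
    (∑' n, k ^ n • T n) ψ =ᵐ[surfaceMeasure D] fun x => pairing D ψ (κ k x) := by
  have hsn := summable_norm_pow_smul (v := T) hTn k
  have hs := hsn.of_norm.hasSum
  have hL := (ContinuousLinearMap.apply ℂ (Lp ℂ 2 (surfaceMeasure D)) ψ).hasSum hs
  have hLn : Summable fun n => ‖(k ^ n • T n) ψ‖ :=
    Summable.of_nonneg_of_le (fun _ => norm_nonneg _) (fun n => (k ^ n • T n).le_opNorm ψ)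
      (hsn.mul_right _)
  have hae := Lp.hasSum_coeFn_tsum (tsum_enorm_ne_top_iff_summable_norm.2 hLn)
  have e : ∑' n, (k ^ n • T n) ψ = (∑' n, k ^ n • T n) ψ := hL.tsum_eq
  rw [e] at hae
  have hterm : ∀ᵐ x ∂surfaceMeasure D, ∀ n, (k ^ n • T n) ψ x = k ^ n * ψ (G n x) := by
    refine ae_all_iff.2 fun n => ?_
    filter_upwards [Lp.coeFn_smul (k ^ n) (T n ψ), hT n ψ] with y h1 h2
    rw [smul_apply, h1, Pi.smul_apply, h2, smul_eq_mul]
  filter_upwards [hae, hterm, ae_mem_frontier D] with x h1 h2 hx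
  obtain ⟨u, hu, huψ⟩ := exists_HHalf_hasSum hκ hG hn k hx
  rw [pairing_eq ψ u hu]
  simp only [h2] at h1
  exact h1.unique (huψ ψ)

end

theorem IsHomogeneousKernel.const_mul {D : Set E3} {B : ℝ} {g : E3 → E3 → ℂ}
    (hg : IsHomogeneousKernel D B g) {c : ℂ} (hc : c ≠ 0) :
    IsHomogeneousKernel D (‖c‖ * B) fun x y => c * g x y where
  pos := mul_pos (norm_pos_iff.2 hc) hg.pos
  measurable := hg.measurable.const_mul c
  norm_le x hx y hy := by
    rw [norm_mul]
    have := hg.norm_le x hx y hy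
    gcongr
  norm_sub_le x hx y hy z hz := by
    rw [← mul_sub, norm_mul, mul_assoc, mul_assoc]
    have := hg.norm_sub_le x hx y hy z hz
    gcongr

theorem IsLipschitzKernel.const_mul {D : Set E3} {B : ℝ} {g : E3 → E3 → ℂ}
    (hg : IsLipschitzKernel D B g) {c : ℂ} (hc : c ≠ 0) :
    IsLipschitzKernel D (‖c‖ * B) fun x y => c * g x y where
  toIsHomogeneousKernel := hg.toIsHomogeneousKernel.const_mul hc
  norm_sub_left_le x hx x' hx' y hy := by
    rw [← mul_sub, norm_mul, mul_assoc]
    have := hg.norm_sub_left_le x hx x' hx' y hy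
    gcongr
  norm_sub_right_le x hx y hy z hz := by
    rw [← mul_sub, norm_mul, mul_assoc]
    have := hg.norm_sub_right_le x hx y hy z hz
    gcongr
  norm_double_le x hx x' hx' y hy z hz := by
    rw [← mul_sub, ← mul_sub, ← mul_sub, norm_mul, mul_assoc, mul_assoc]
    have := hg.norm_double_le x hx x' hx' y hy z hz
    gcongr

theorem factorial_add_two (n : ℕ) :
    ((n + 2).factorial : ℝ) = (n + 2) * (n + 1) * n.factorial := by
  rw [Nat.factorial_succ, Nat.factorial_succ]
  push_cast
  ring

/-- The Taylor coefficients times the constants of the kernels `|x - y| ^ (n + 1)` decay like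
`R ^ n / n!`. -/
theorem norm_gamCoeff_mul_le {R : ℝ} (hR : 1 ≤ R) (n : ℕ) :
    ‖gamCoeff n‖ * (5 * (n + 1 : ℕ) ^ 2 * R ^ (n + 1 + 1)) ≤ 5 * R ^ 2 * (R ^ n / n.factorial) := by
  have hf : (0 : ℝ) < n.factorial := by positivity
  calc _ ≤ 1 / ((n + 2).factorial : ℝ) * (5 * (n + 1 : ℕ) ^ 2 * R ^ (n + 1 + 1)) := by
        gcongr
        exact norm_gamCoeff_le n
    _ = 5 * R ^ 2 * (R ^ n / n.factorial) * ((n + 1) / (n + 2)) := by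
        rw [factorial_add_two]
        push_cast
        field_simp
        ring
    _ ≤ 5 * R ^ 2 * (R ^ n / n.factorial) * 1 := by
        gcongr
        rw [div_le_one (by positivity)]
        linarith
    _ = _ := mul_one _

theorem norm_gamCoeff_mul_succ_le {R : ℝ} (hR : 1 ≤ R) (n : ℕ) :
    ‖gamCoeff n * (n + 1)‖ * ((n + 2) * R ^ (n + 1)) ≤ R * (R ^ n / n.factorial) := by
  have hf : (0 : ℝ) < n.factorial := by positivity
  have e : ‖(n : ℂ) + 1‖ = n + 1 := by
    rw [← Nat.cast_succ, Complex.norm_natCast, Nat.cast_succ]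
  rw [norm_mul, e]
  calc _ ≤ 1 / ((n + 2).factorial : ℝ) * (n + 1) * ((n + 2) * R ^ (n + 1)) := by
        gcongr
        exact norm_gamCoeff_le n
    _ = _ := by
        rw [factorial_add_two]
        field_simp
        ring

/-- The embedding of `L²(∂D)` into `H^{-1/2}(∂D)` as a continuous linear map. -/
noncomputable def ofL2L (D : Set E3) : Lp ℂ 2 (surfaceMeasure D) →L[ℂ] HNegHalf D :=
  (ContinuousLinearMap.precomp ℂ (HHalf.toL2 D)).comp
    ((ContinuousLinearMap.mul ℂ ℂ).lpPairing (surfaceMeasure D) 2 2)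

theorem AnalyticOnNhd.clm_comp_const {F E E' : Type*} [NormedAddCommGroup F] [NormedSpace ℂ F]
    [NormedAddCommGroup E] [NormedSpace ℂ E] [NormedAddCommGroup E'] [NormedSpace ℂ E']
    {K : ℂ → F →L[ℂ] E} {s : Set ℂ} (hK : AnalyticOnNhd ℂ K s) (L : E →L[ℂ] E') :
    AnalyticOnNhd ℂ (fun k => L.comp (K k)) s :=
  (ContinuousLinearMap.compL ℂ F E E' L).comp_analyticOnNhd hK

/-- The kernels `Γ₁^k(x - ·)` belong to `H^{1/2}(∂D)`, and the operators `S₁^k` are compact and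
analytic in `k`. -/
theorem exists_singleLayer1 {D : Set E3} (hD : IsBoundedLipschitzDomain D) :
    (∀ (k : ℂ), ∀ x ∈ frontier D, MemHHalf D fun y => Gam1 k (x - y)) ∧
    ∃ S : ℂ → (HNegHalf D →L[ℂ] HHalf D),
      (∀ k ψ, HHalf.toL2 D (S k ψ) =ᵐ[surfaceMeasure D] singleLayer1 D k ψ) ∧
      (∀ k, IsCompactOperator (S k)) ∧ AnalyticOnNhd ℂ S Set.univ := by
  have := hD.isFiniteMeasure_surfaceMeasure
  obtain ⟨R, hR, hdiam⟩ := hD.exists_diameter_bound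
  obtain ⟨Λ, hΛ, hop⟩ := hD.exists_operator_of_isLipschitzKernel
  set g : ℕ → E3 → E3 → ℂ := fun n x y => gamCoeff n * (‖x - y‖ ^ (n + 1) : ℝ) with hg
  have hker : ∀ n, IsLipschitzKernel D (‖gamCoeff n‖ * (5 * (n + 1 : ℕ) ^ 2 * R ^ (n + 1 + 1)))
      (g n) := fun n =>
    (isLipschitzKernel_norm_pow hR hdiam (n + 1) (by omega)).const_mul (gamCoeff_ne_zero n)
  choose G T hG hGn hTc hTn hT using fun n => hop _ (g n) (hker n)
  have hle : ∀ n, Λ * (‖gamCoeff n‖ * (5 * (n + 1 : ℕ) ^ 2 * R ^ (n + 1 + 1))) ≤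
      Λ * (5 * R ^ 2) * (R ^ n / n.factorial) := fun n => by
    rw [mul_assoc Λ (5 * R ^ 2)]
    exact mul_le_mul_of_nonneg_left (norm_gamCoeff_mul_le hR n) hΛ
  have hGn' := fun n x hx => (hGn n x hx).trans (hle n)
  have hTn' := fun n => (hTn n).trans (hle n)
  have hκ : ∀ k, ∀ x ∈ frontier D, ∀ᵐ y ∂surfaceMeasure D,
      HasSum (fun n => k ^ n * g n x y) (Gam1 k (x - y)) := fun k x _ =>
    Filter.Eventually.of_forall fun y => hasSum_Gam1 k (x - y)
  refine ⟨fun k x hx => ?_, fun k => ∑' n, k ^ n • T n, fun k ψ => ?_,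
    isCompactOperator_tsum_pow_smul hTn' hTc, analyticOnNhd_tsum_pow_smul hTn'⟩
  · obtain ⟨u, hu, -⟩ := exists_HHalf_hasSum (κ := fun k x y => Gam1 k (x - y)) hκ hG hGn' k hx
    exact ⟨u, hu⟩
  · have hs := (summable_norm_pow_smul (v := T) hTn' k).of_norm.hasSum
    have e : HHalf.toL2 D ((∑' n, k ^ n • T n) ψ) =
        (∑' n, k ^ n • (HHalf.toL2 D).comp (T n)) ψ := by
      have h := (ContinuousLinearMap.compL ℂ (HNegHalf D) (HHalf D) _ (HHalf.toL2 D)).hasSum hs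
      simp only [map_smul, ContinuousLinearMap.compL_apply] at h
      rw [h.tsum_eq]
      rfl
    rw [e]
    refine tsum_ae_eq_pairing (κ := fun k x y => Gam1 k (x - y)) hκ hG hGn'
      (M' := ‖HHalf.toL2 D‖ * (Λ * (5 * R ^ 2))) (fun n => ?_) hT k ψ
    rw [mul_assoc]
    refine ((HHalf.toL2 D).opNorm_comp_le (T n)).trans ?_
    have := hTn' n
    gcongr

/-- The kernels `∂Γ₁^k(x - ·)/∂ν(x)` belong to `H^{1/2}(∂D)`, and the operators `K₁^{*,k}`, with
values in `L²(∂D)`, are compact and analytic in `k`. -/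
theorem exists_adjointDoubleLayer1 {D : Set E3} (hD : IsBoundedLipschitzDomain D) :
    (∀ (k : ℂ), ∀ x ∈ frontier D, MemHHalf D fun y => dnGam1 D k x y) ∧
    ∃ K : ℂ → (HNegHalf D →L[ℂ] Lp ℂ 2 (surfaceMeasure D)),
      (∀ k ψ, K k ψ =ᵐ[surfaceMeasure D] adjointDoubleLayer1 D k ψ) ∧
      (∀ k, IsCompactOperator (K k)) ∧ AnalyticOnNhd ℂ K Set.univ := by
  have := hD.isFiniteMeasure_surfaceMeasure
  obtain ⟨R, hR, hdiam⟩ := hD.exists_diameter_bound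
  obtain ⟨Λ, hΛ, hop⟩ := hD.exists_operator_of_isHomogeneousKernel
  set g : ℕ → E3 → E3 → ℂ := fun n x y => (gamCoeff n * (n + 1)) *
    (‖x - y‖ ^ n * (inner ℝ (outwardNormal D x) (x - y) / ‖x - y‖) : ℝ) with hg
  have hker : ∀ n : ℕ, IsHomogeneousKernel D
      (‖gamCoeff n * (n + 1)‖ * ((n + 2) * R ^ (n + 1))) (g n) := fun n =>
    (isHomogeneousKernel_inner hR hdiam (measurable_outwardNormal D)
      (norm_outwardNormal_le D) n).const_mul
      (mul_ne_zero (gamCoeff_ne_zero n) (Nat.cast_add_one_ne_zero n))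
  choose G T hG hGn _ _ hTc hTn hT using fun n => hop _ (g n) (hker n)
  have hle : ∀ n : ℕ, Λ * (‖gamCoeff n * (n + 1)‖ * ((n + 2) * R ^ (n + 1))) ≤
      Λ * R * (R ^ n / n.factorial) := fun n => by
    rw [mul_assoc Λ R]
    exact mul_le_mul_of_nonneg_left (norm_gamCoeff_mul_succ_le hR n) hΛ
  have hGn' := fun n x hx => (hGn n x hx).trans (hle n)
  have hTn' := fun n => (hTn n).trans (hle n)
  have hκ : ∀ k, ∀ x ∈ frontier D, ∀ᵐ y ∂surfaceMeasure D,
      HasSum (fun n => k ^ n * g n x y) (dnGam1 D k x y) := fun k x _ => by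
    -- at `y = x` the kernel is not differentiable, and the value of `dnGam1` there has no meaning
    have hne : ∀ᵐ y ∂surfaceMeasure D, y ≠ x := by
      rw [ae_iff]
      simpa using surfaceMeasure_singleton D x
    filter_upwards [hne] with y hy
    exact hasSum_fderiv_Gam1 k (sub_ne_zero.2 hy.symm) (outwardNormal D x)
  refine ⟨fun k x hx => ?_, fun k => ∑' n, k ^ n • T n,
    tsum_ae_eq_pairing (κ := dnGam1 D) hκ hG hGn' hTn' hT,
    isCompactOperator_tsum_pow_smul hTn' hTc, analyticOnNhd_tsum_pow_smul hTn'⟩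
  obtain ⟨u, hu, -⟩ := exists_HHalf_hasSum (κ := dnGam1 D) hκ hG hGn' k hx
  exact ⟨u, hu⟩

/-! ### Boundedness, compactness and analyticity -/

theorem lemma3p1 (D : Set E3) (hD : IsBoundedLipschitzDomain D) :
    -- the kernels belong to the trace space, so the duality pairings below make sense
    (∀ (k : ℂ), ∀ x ∈ frontier D,
      MemHHalf D (fun y => Gam1 k (x - y)) ∧ MemHHalf D (fun y => dnGam1 D k x y)) ∧
    ∃ (S : ℂ → (HNegHalf D →L[ℂ] HHalf D)) (K : ℂ → (HNegHalf D →L[ℂ] HNegHalf D)),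
      -- `S k` and `K k` are the integral operators with these kernels
      (∀ (k : ℂ) (ψ : HNegHalf D),
        HHalf.toL2 D (S k ψ) =ᵐ[surfaceMeasure D] singleLayer1 D k ψ) ∧
      (∀ (k : ℂ) (ψ : HNegHalf D), ∃ g : Lp ℂ 2 (surfaceMeasure D),
        g =ᵐ[surfaceMeasure D] adjointDoubleLayer1 D k ψ ∧ K k ψ = HNegHalf.ofL2 D g) ∧
      (∀ k : ℂ, IsCompactOperator (S k)) ∧
      (∀ k : ℂ, IsCompactOperator (K k)) ∧
      AnalyticOnNhd ℂ S Set.univ ∧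
      AnalyticOnNhd ℂ K Set.univ := by
  obtain ⟨hSm, S, hS, hSc, hSa⟩ := exists_singleLayer1 hD
  obtain ⟨hKm, K, hK, hKc, hKa⟩ := exists_adjointDoubleLayer1 hD
  refine ⟨fun k x hx => ⟨hSm k x hx, hKm k x hx⟩, S, fun k => (ofL2L D).comp (K k), hS,
    fun k ψ => ⟨K k ψ, hK k ψ, rfl⟩, hSc, fun k => (hKc k).clm_comp (ofL2L D), hSa, ?_⟩
  exact hKa.clm_comp_const (ofL2L D)
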